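/- **Conventions.** An *ionad* is a set $X$ of points with a finite-limit-preserving comonad $I_X$ on $\mathbf{Set}^X$; $\mathcal O(X)$ is its category of $I_X$-coalgebras, with forgetful functor $U_X:\mathcal O(X)\to\mathbf{Set}^X$. A *continuous map* $X\to Y$ is a function $f$ with a functor $f^*:\mathcal O(Y)\to\mathcal O(X)$ such that $U_Xf^*=f^{-1}U_Y$; a *specialisation* $f\Rightarrow g$ is any natural transformation $f^*\Rightarrow g^*$. A *basis* on a set $X$ is a functor $M:\mathcal B\to\mathbf{Set}^X$ with $\mathcal B$ small such that for each $x\in X$ the category of elements of $M(-)(x)$ is cofiltered; it generates the comonad of the adjunction $M\otimes(-)\dashv[M,-]$ between $\mathbf{Set}^{\mathcal B^{\mathrm{op}}}$ and $\mathbf{Set}^X$, where $M\otimes(-)$ is the colimit-preserving extension of $M$ along the Yoneda embedding. An ionad is *bounded* if it is generated, up to isomorphism, by a basis. $\mathbf{BIon}$ is the 2-category of bounded ionads, continuous maps and specialisations, and $1$ is the ionad with one point and identity comonad. $\mathbf{Cat}$ is the 2-category of small categories. The 2-functor $A:\mathbf{Cat}\to\mathbf{BIon}$ sends $\mathcal C$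 to the ionad $A(\mathcal C)$ with points $\operatorname{ob}\mathcal C$ and with the comonad induced by restriction and right Kan extension along $\operatorname{ob}\mathcal C\to\mathcal C$, so that $\mathcal O(A(\mathcal C))\cong\mathbf{Set}^{\mathcal C}$; on functors and natural transformations it is given by $F\mapsto\mathbf{Set}^F$. Tensors $\mathcal C\otimes X$ and products are meant in the 2-categorical sense, i.e. $\mathbf{BIon}(\mathcal C\otimes X,Y)\cong[\mathcal C,\mathbf{BIon}(X,Y)]$ and $\mathbf{BIon}(Z,X\times Y)\cong\mathbf{BIon}(Z,X)\times\mathbf{BIon}(Z,Y)$, 2-naturally, as isomorphisms of categories. **Statement.** Let $\mathcal C$ be a small category and $X$ a bounded ionad. 1. The tensor $\mathcal C\otimes X$ exists in $\mathbf{BIon}$. If $X$ is generated by a basis $M:\mathcal B\to\mathbf{Set}^X$, then $$N:\mathcal C^{\mathrm{op}}\times\mathcal B\to\mathbf{Set}^{\operatorname{ob}\mathcal C\times X},\qquad N(c,b)(c',x)=\mathcal C(c,c')\times M(b)(x)$$ is a basis, and it generates an ionad with set of points $\operatorname{ob}\mathcal C\times X$ which is the tensor $\mathcal C\otimes X$,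 the continuous map $X\to\mathcal C\otimes X$ indexed by $c\in\mathcal C$ being $x\mapsto(c,x)$ on points. 2. $\mathcal C\otimes X$ is the product $A(\mathcal C)\times X$ in $\mathbf{BIon}$. The projection to $X$ corresponds to the constant functor $\mathcal C\to\mathbf{BIon}(X,X)$ at $1_X$, and the projection to $A(\mathcal C)$ corresponds to the composite of the canonical functor $\kappa_{\mathcal C}:\mathcal C\to\mathbf{BIon}(1,A(\mathcal C))$, sending an object to the corresponding point, with precomposition by a continuous map $X\to 1$. 3. There is a 2-natural isomorphism $A\cong(-)\otimes 1:\mathbf{Cat}\to\mathbf{BIon}$, compatible with $\kappa$ and the units of the tensors. 4. The specialisation 2-functor $V=\mathbf{BIon}(1,-)$ takes values in $\mathbf{Cat}$ (its values are isomorphic to small categories), and there are 2-adjunctions $(-)\otimes1\dashv V$ and $A\dashv V:\mathbf{BIon}\to\mathbf{Cat}$. That is, the Alexandroff embedding $A$ is left 2-adjoint to $V$. -/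

import Mathlib

open CategoryTheory CategoryTheory.Limits CategoryTheory.Bicategory

universe u

/-! ### Ionads, continuous maps, specialisations -/

/-- The inverse image functor `f⁻¹ : Set^Y ⥤ Set^X` of a function `f : X → Y`. -/
@[simps]
def pullFam {X Y : Type u} (f : X → Y) : (Y → Type u) ⥤ (X → Type u) where
  obj A := fun x => A (f x)
  map φ := fun x => φ (f x)

/-- An ionad: a set of points together with a finite-limit-preserving comonad on `Set^pts`. -/
structure Ionad : Type (u + 1) where
  pts : Type u
  int : Comonad (pts → Type u)
  cartesian : PreservesFiniteLimits int.toFunctor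

namespace Ionad

/-- The category of opens: the coalgebras of the interior comonad. -/
abbrev Opens (X : Ionad.{u}) : Type (u + 1) := X.int.Coalgebra

/-- The forgetful functor from opens to families of sets. -/
abbrev forgetOpens (X : Ionad.{u}) : X.Opens ⥤ (X.pts → Type u) := X.int.forget

/-- A continuous map: a function together with a (strict) lifting of its inverse image functor
through the categories of opens. -/
@[ext]
structure Map (X Y : Ionad.{u}) : Type (u + 1) where
  toFun : X.pts → Y.pts
  star : Y.Opens ⥤ X.Opens
  comm : star ⋙ X.forgetOpens = Y.forgetOpens ⋙ pullFam toFun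

/-- A specialisation: an arbitrary natural transformation between the liftings. -/
@[ext]
structure Specialisation {X Y : Ionad.{u}} (f g : Map X Y) : Type (u + 1) where
  nat : f.star ⟶ g.star

/-- The identity continuous map. -/
@[simps]
def Map.id (X : Ionad.{u}) : Map X X where
  toFun := fun x => x
  star := 𝟭 _
  comm := rfl

/-- Composition of continuous maps. -/
@[simps]
def Map.comp {X Y Z : Ionad.{u}} (f : Map X Y) (g : Map Y Z) : Map X Z where
  toFun := fun x => g.toFun (f.toFun x)
  star := g.star ⋙ f.star
  comm := by
    rw [Functor.assoc, f.comm, ← Functor.assoc, g.comm]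
    rfl

instance : CategoryStruct Ionad.{u} where
  Hom X Y := Map X Y
  id X := Map.id X
  comp f g := Map.comp f g

instance (X Y : Ionad.{u}) : Category (X ⟶ Y) where
  Hom f g := Specialisation f g
  id f := ⟨𝟙 f.star⟩
  comp a b := ⟨a.nat ≫ b.nat⟩
  id_comp _ := Specialisation.ext (Category.id_comp _)
  comp_id _ := Specialisation.ext (Category.comp_id _)
  assoc _ _ _ := Specialisation.ext (Category.assoc _ _ _)

@[simp] lemma id_star (X : Ionad.{u}) : Map.star (𝟙 X) = 𝟭 _ := rfl
@[simp] lemma comp_star {X Y Z : Ionad.{u}} (f : X ⟶ Y) (g : Y ⟶ Z) :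
    Map.star (f ≫ g) = Map.star g ⋙ Map.star f := rfl
@[simp] lemma id_nat {X Y : Ionad.{u}} (f : X ⟶ Y) :
    Specialisation.nat (𝟙 f) = 𝟙 (Map.star f) := rfl
@[simp] lemma comp_nat {X Y : Ionad.{u}} {f g h : X ⟶ Y} (a : f ⟶ g) (b : g ⟶ h) :
    Specialisation.nat (a ≫ b) = Specialisation.nat a ≫ Specialisation.nat b := rfl

@[ext]
lemma hom₂_ext {X Y : Ionad.{u}} {f g : X ⟶ Y} {a b : f ⟶ g}
    (h : Specialisation.nat a = Specialisation.nat b) : a = b := Specialisation.ext h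

lemma eqToHom_nat {X Y : Ionad.{u}} {f g : X ⟶ Y} (h : f = g) :
    Specialisation.nat (eqToHom h) = eqToHom (congrArg Map.star h) := by
  subst h; rfl

/-- Whiskering of a specialisation with a continuous map on the left. -/
@[simps]
def whiskerL {X Y Z : Ionad.{u}} (f : X ⟶ Y) {g h : Y ⟶ Z} (a : g ⟶ h) :
    Specialisation (f ≫ g) (f ≫ h) where
  nat := Functor.whiskerRight (Specialisation.nat a) (Map.star f)

/-- Whiskering of a specialisation with a continuous map on the right. -/
@[simps]
def whiskerR {X Y Z : Ionad.{u}} {f g : X ⟶ Y} (a : f ⟶ g) (h : Y ⟶ Z) :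
    Specialisation (f ≫ h) (g ≫ h) where
  nat := Functor.whiskerLeft (Map.star h) (Specialisation.nat a)

/-- Ionads, continuous maps and specialisations form a 2-category. -/
instance : Bicategory Ionad.{u} where
  homCategory X Y := inferInstance
  whiskerLeft f _ _ a := whiskerL f a
  whiskerRight a h := whiskerR a h
  associator f g h := Iso.refl (f ≫ (g ≫ h))
  leftUnitor f := Iso.refl f
  rightUnitor f := Iso.refl f
  whiskerLeft_id f g := Specialisation.ext (Functor.whiskerRight_id' _)
  whiskerLeft_comp f _ _ _ a b := Specialisation.ext (Functor.whiskerRight_comp _ _ _)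
  id_whiskerLeft a := Specialisation.ext (NatTrans.ext (funext fun A => by
    exact ((Category.id_comp _).trans (Category.comp_id _)).symm))
  comp_whiskerLeft f g _ _ a := Specialisation.ext (NatTrans.ext (funext fun A => by
    exact ((Category.id_comp _).trans (Category.comp_id _)).symm))
  id_whiskerRight f g := Specialisation.ext (Functor.whiskerLeft_id' _)
  comp_whiskerRight a b f := Specialisation.ext (Functor.whiskerLeft_comp _ _ _)
  whiskerRight_id a := Specialisation.ext (NatTrans.ext (funext fun A => by
    exact ((Category.id_comp _).trans (Category.comp_id _)).symm))
  whiskerRight_comp a f g := Specialisation.ext (NatTrans.ext (funext fun A => by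
    exact ((Category.id_comp _).trans (Category.comp_id _)).symm))
  whisker_assoc f _ _ a g := Specialisation.ext (NatTrans.ext (funext fun A => by
    exact ((Category.id_comp _).trans (Category.comp_id _)).symm))
  whisker_exchange {_ _ _ f g h i} a b := Specialisation.ext (NatTrans.ext (funext fun A => by
    exact (Specialisation.nat a).naturality ((Specialisation.nat b).app A)))
  pentagon f g h i := Specialisation.ext (NatTrans.ext (funext fun A => by
    change (Map.star f).map (𝟙 _) ≫ 𝟙 _ ≫ 𝟙 _ = 𝟙 _ ≫ 𝟙 _
    simp))
  triangle f g := Specialisation.ext (NatTrans.ext (funext fun A => by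
    change 𝟙 _ ≫ (Map.star f).map (𝟙 _) = 𝟙 _
    simp))

instance : Bicategory.Strict Ionad.{u} where
  id_comp _ := rfl
  comp_id _ := rfl
  assoc _ _ _ := rfl
  leftUnitor_eqToIso _ := rfl
  rightUnitor_eqToIso _ := rfl
  associator_eqToIso _ _ _ := rfl

end Ionad

/-! ### Bases and bounded ionads -/

/-- `M : B ⥤ Set^X` is flat: for each `x`, the category of elements of `M(–)(x)` is cofiltered. -/
def IsFlat {X B : Type u} [SmallCategory B] (M : B ⥤ (X → Type u)) : Prop :=
  ∀ x : X, IsCofiltered (M ⋙ Pi.eval (fun _ : X => Type u) x).Elements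

/-- The comonad `I` is (isomorphic to) the one induced by the adjunction `M ⊗ (–) ⊣ [M, –]`, where
`M ⊗ (–) : Set^(Bᵒᵖ) ⥤ Set^X` is the extension of `M` along the Yoneda embedding to a functor with
a right adjoint (equivalently, a colimit-preserving functor). -/
def Generates {X B : Type u} [SmallCategory B] (M : B ⥤ (X → Type u))
    (I : Comonad (X → Type u)) : Prop :=
  ∃ (L : (Bᵒᵖ ⥤ Type u) ⥤ (X → Type u)) (R : (X → Type u) ⥤ (Bᵒᵖ ⥤ Type u)) (adj : L ⊣ R),
    Nonempty (yoneda ⋙ L ≅ M) ∧ Nonempty (adj.toComonad ≅ I)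

namespace Ionad

/-- `M` is a basis which generates the ionad `X` (up to isomorphism). -/
def IsGeneratedBy (X : Ionad.{u}) {B : Type u} [SmallCategory B] (M : B ⥤ (X.pts → Type u)) :
    Prop :=
  IsFlat M ∧ Generates M X.int

/-- An ionad is bounded if it is generated by some (small) basis. -/
def IsBounded (X : Ionad.{u}) : Prop :=
  ∃ (B : Type u) (_ : SmallCategory B) (M : B ⥤ (X.pts → Type u)), X.IsGeneratedBy M

end Ionad

/-- Bounded ionads. -/
structure BIon : Type (u + 1) where
  ion : Ionad.{u}
  bounded : ion.IsBounded

/-- `BIon` is the full and locally full sub-2-category of ionads on the bounded ones. -/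
instance : Bicategory BIon.{u} where
  Hom X Y := X.ion ⟶ Y.ion
  id X := 𝟙 X.ion
  comp f g := Bicategory.toCategoryStruct.comp (obj := Ionad.{u}) f g
  homCategory X Y := inferInstanceAs (Category (X.ion ⟶ Y.ion))
  whiskerLeft f _ _ a := Bicategory.whiskerLeft (B := Ionad.{u}) f a
  whiskerRight a h := Bicategory.whiskerRight (B := Ionad.{u}) a h
  associator f g h := Bicategory.associator (B := Ionad.{u}) f g h
  leftUnitor f := Bicategory.leftUnitor (B := Ionad.{u}) f
  rightUnitor f := Bicategory.rightUnitor (B := Ionad.{u}) f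
  whiskerLeft_id f g := Bicategory.whiskerLeft_id (B := Ionad.{u}) f g
  whiskerLeft_comp f _ _ _ a b := Bicategory.whiskerLeft_comp (B := Ionad.{u}) f a b
  id_whiskerLeft a := Bicategory.id_whiskerLeft (B := Ionad.{u}) a
  comp_whiskerLeft f g _ _ a := Bicategory.comp_whiskerLeft (B := Ionad.{u}) f g a
  id_whiskerRight f g := Bicategory.id_whiskerRight (B := Ionad.{u}) f g
  comp_whiskerRight a b f := Bicategory.comp_whiskerRight (B := Ionad.{u}) a b f
  whiskerRight_id a := Bicategory.whiskerRight_id (B := Ionad.{u}) a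
  whiskerRight_comp a f g := Bicategory.whiskerRight_comp (B := Ionad.{u}) a f g
  whisker_assoc f _ _ a g := Bicategory.whisker_assoc (B := Ionad.{u}) f a g
  whisker_exchange a b := Bicategory.whisker_exchange (B := Ionad.{u}) a b
  pentagon f g h i := Bicategory.pentagon (B := Ionad.{u}) f g h i
  triangle f g := Bicategory.triangle (B := Ionad.{u}) f g

instance : Bicategory.Strict BIon.{u} where
  id_comp _ := rfl
  comp_id _ := rfl
  assoc _ _ _ := rfl
  leftUnitor_eqToIso _ := rfl
  rightUnitor_eqToIso _ := rfl
  associator_eqToIso _ _ _ := rfl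

/-! ### The Alexandroff embedding -/

section Alexandroff

variable (C : Type u) [SmallCategory C]

/-- Restriction `Set^C ⥤ Set^(ob C)` along the inclusion of objects. -/
@[simps]
def restrictOb : (C ⥤ Type u) ⥤ (C → Type u) where
  obj F := F.obj
  map α := α.app

/-- Right Kan extension `Set^(ob C) ⥤ Set^C` along the inclusion of objects. -/
@[simps]
def ranOb : (C → Type u) ⥤ (C ⥤ Type u) where
  obj A :=
    { obj := fun c => ∀ d : C, (c ⟶ d) → A d
      map := fun g => ↾fun φ d h => φ d (g ≫ h) }
  map α := { app := fun c => ↾fun φ d h => α d (φ d h) }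

/-- Left Kan extension `Set^(ob C) ⥤ Set^C` along the inclusion of objects. -/
@[simps]
def lanOb : (C → Type u) ⥤ (C ⥤ Type u) where
  obj A :=
    { obj := fun c => Σ d : C, (d ⟶ c) × A d
      map := fun g => ↾fun t => ⟨t.1, t.2.1 ≫ g, t.2.2⟩ }
  map α := { app := fun c => ↾fun t => ⟨t.1, t.2.1, α t.1 t.2.2⟩ }

/-- The adjunction between restriction and right Kan extension. -/
def ranObAdj : restrictOb C ⊣ ranOb C where
  unit :=
    { app := fun F =>
        { app := fun c => ↾fun e d h => F.map h e
          naturality := fun c c' g => by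
            ext e
            funext d h
            exact (congrArg (fun k => k e) (F.map_comp g h)).symm }
      naturality := fun F G α => by
        ext c e
        funext d h
        exact (congrArg (fun k => k e) (α.naturality h)).symm }
  counit := { app := fun A => fun c => ↾fun φ => φ c (𝟙 c) }
  left_triangle_components F := by
    funext c
    ext e
    exact congrArg (fun k => k e) (F.map_id c)
  right_triangle_components A := by
    ext c φ
    funext d h
    exact congrArg (φ d) (Category.comp_id h)

/-- The adjunction between left Kan extension and restriction. -/
def lanObAdj : lanOb C ⊣ restrictOb C where
  unit := { app := fun A => fun c => ↾fun a => ⟨c, 𝟙 c, a⟩ }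
  counit :=
    { app := fun F =>
        { app := fun c => ↾fun t => F.map t.2.1 t.2.2
          naturality := fun c c' g => by
            ext t
            exact congrArg (fun k => k t.2.2) (F.map_comp t.2.1 g) }
      naturality := fun F G α => by
        ext c t
        exact (congrArg (fun k => k t.2.2) (α.naturality t.2.1)).symm }
  left_triangle_components A := by
    ext c t
    exact congrArg (fun k => (⟨t.1, k, t.2.2⟩ : Σ d : C, (d ⟶ c) × A d)) (Category.id_comp t.2.1)
  right_triangle_components F := by
    funext c
    ext e
    exact congrArg (fun k => k e) (F.map_id c)

/-- The Alexandroff ionad of a small category: its points are the objects, and its interior comonad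
is induced by restriction and right Kan extension along the inclusion of objects. -/
def alexIonad : Ionad.{u} where
  pts := C
  int := (ranObAdj C).toComonad
  cartesian := by
    have h₁ := (ranObAdj C).rightAdjoint_preservesLimits
    have h₂ := (lanObAdj C).rightAdjoint_preservesLimits
    change PreservesFiniteLimits (ranOb C ⋙ restrictOb C)
    infer_instance

/-- The comparison functor from `Set^C` to the opens of the Alexandroff ionad. -/
def functorToOpens : (C ⥤ Type u) ⥤ (alexIonad C).Opens :=
  Comonad.comparison (ranObAdj C)

/-- The inverse of the comparison functor: a coalgebra is the same thing as a functor. -/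
def opensToFunctor : (alexIonad C).Opens ⥤ (C ⥤ Type u) where
  obj P :=
    { obj := P.A
      map := fun {c d} g => ↾fun e => P.a c e d g
      map_id := fun c => by
        ext e
        exact congrArg (fun k => k e) (congrFun P.counit c)
      map_comp := fun {c d d'} g h => by
        ext e
        exact (congrArg (fun k => k e d g d' h) (congrFun P.coassoc c)) }
  map {P Q} φ :=
    { app := φ.f
      naturality := fun c d g => by
        ext e
        exact (congrArg (fun k => k e d g) (congrFun φ.h c)) }

lemma functorToOpens_opensToFunctor : functorToOpens C ⋙ opensToFunctor C = 𝟭 _ := rfl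

lemma opensToFunctor_functorToOpens : opensToFunctor C ⋙ functorToOpens C = 𝟭 _ := rfl

/-- The canonical basis `Cᵒᵖ ⥤ Set^(ob C)`, sending `c` to the family `d ↦ Cᵒᵖ(d, c) = C(c, d)`. -/
def alexBasis : Cᵒᵖ ⥤ (C → Type u) :=
  yoneda ⋙ (Functor.whiskeringLeft _ _ _).obj (opOp C) ⋙ restrictOb C

lemma alexBasis_isFlat : IsFlat (alexBasis C) := fun d => by
  refine IsCofiltered.of_isInitial (X := ⟨Opposite.op d, 𝟙 (Opposite.op d)⟩) _ ?_
  refine IsInitial.ofUniqueHom (fun t => ⟨t.2, Category.id_comp t.2⟩) ?_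
  intro t m
  apply Subtype.ext
  have h : 𝟙 (Opposite.op d) ≫ m.1 = t.2 := m.2
  rw [Category.id_comp] at h
  exact h

/-- The adjunction inducing the interior comonad of the Alexandroff ionad, transported along the
isomorphism between presheaves on `Cᵒᵖ` and covariant presheaves on `C`. -/
def alexBasisAdj :
    ((Functor.whiskeringLeft _ _ _).obj (opOp C) ⋙ restrictOb C) ⊣
      (ranOb C ⋙ (Functor.whiskeringLeft _ _ _).obj (unopUnop C)) where
  unit :=
    { app := fun P => Functor.whiskerLeft (unopUnop C) ((ranObAdj C).unit.app (opOp C ⋙ P))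
      naturality := fun P Q α => by
        ext c e
        exact congrArg (fun k => (k.app c.unop.unop) e)
          ((ranObAdj C).unit.naturality (Functor.whiskerLeft (opOp C) α)) }
  counit := (ranObAdj C).counit
  left_triangle_components P := (ranObAdj C).left_triangle_components (opOp C ⋙ P)
  right_triangle_components A := congrArg (Functor.whiskerLeft (unopUnop C))
    ((ranObAdj C).right_triangle_components A)

lemma alexIonad_isBounded : (alexIonad C).IsBounded :=
  ⟨Cᵒᵖ, inferInstance, alexBasis C, alexBasis_isFlat C, _, _, alexBasisAdj C,
    ⟨Iso.refl _⟩, ⟨ComonadIso.mk (Iso.refl (ranOb C ⋙ restrictOb C))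
      (fun _ => rfl) (fun _ => rfl)⟩⟩

end Alexandroff

/-- The action of the Alexandroff construction on functors: the lifting is `Set^F`, via the
identification of the categories of opens with functor categories. -/
def alexMap {C D : Type u} [SmallCategory C] [SmallCategory D] (F : C ⥤ D) :
    alexIonad C ⟶ alexIonad D :=
  { toFun := F.obj
    star := opensToFunctor D ⋙ (Functor.whiskeringLeft C D (Type u)).obj F ⋙ functorToOpens C
    comm := rfl : Ionad.Map (alexIonad C) (alexIonad D) }

/-- The action of the Alexandroff construction on natural transformations. -/
def alexMap₂ {C D : Type u} [SmallCategory C] [SmallCategory D] {F G : C ⥤ D} (α : F ⟶ G) :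
    alexMap F ⟶ alexMap G :=
  { nat := Functor.whiskerLeft (opensToFunctor D) (Functor.whiskerRight
      ((Functor.whiskeringLeft C D (Type u)).map α) (functorToOpens C)) :
      Ionad.Specialisation (alexMap F) (alexMap G) }

lemma alexMap₂_id {C D : Type u} [SmallCategory C] [SmallCategory D] (F : C ⥤ D) :
    alexMap₂ (𝟙 F) = 𝟙 (alexMap F) :=
  Ionad.Specialisation.ext (NatTrans.ext (funext fun P => Comonad.Coalgebra.Hom.ext
    (funext fun c => ((opensToFunctor D).obj P).map_id (F.obj c))))

lemma alexMap₂_comp {C D : Type u} [SmallCategory C] [SmallCategory D] {F G H : C ⥤ D}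
    (α : F ⟶ G) (β : G ⟶ H) : alexMap₂ (α ≫ β) = alexMap₂ α ≫ alexMap₂ β :=
  Ionad.Specialisation.ext (NatTrans.ext (funext fun P => Comonad.Coalgebra.Hom.ext
    (funext fun c => ((opensToFunctor D).obj P).map_comp (α.app c) (β.app c))))

/-- The Alexandroff embedding `A : Cat ⥤ BIon`, as a (strict) 2-functor. -/
def alexandroff : StrictPseudofunctor Cat.{u, u} BIon.{u} :=
  StrictPseudofunctor.mk''
    { obj := fun C => ⟨alexIonad C, alexIonad_isBounded C⟩
      map := fun F => alexMap F.toFunctor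
      map₂ := fun α => alexMap₂ α.toNatTrans
      map₂_id := fun F => alexMap₂_id F.toFunctor
      map₂_comp := fun a b => alexMap₂_comp a.toNatTrans b.toNatTrans
      map_id := fun _ => rfl
      map_comp := fun _ _ => rfl
      map₂_whisker_left := fun _ _ _ _ => ((Category.id_comp _).trans (Category.comp_id _)).symm
      map₂_whisker_right := fun _ _ => ((Category.id_comp _).trans (Category.comp_id _)).symm }

/-- The terminal ionad: one point, and the identity comonad. -/
def oneIonad : Ionad.{u} where
  pts := PUnit
  int := Comonad.id _
  cartesian := by
    change PreservesFiniteLimits (𝟭 (PUnit.{u + 1} → Type u))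
    infer_instance

/-- The basis of the terminal ionad, indexed by the terminal category. -/
def oneBasis : Discrete PUnit.{u + 1} ⥤ (PUnit.{u + 1} → Type u) :=
  (Functor.const _).obj fun _ => PUnit

lemma oneBasis_isFlat : IsFlat oneBasis.{u} := fun x => by
  refine IsCofiltered.of_isInitial (X := ⟨⟨PUnit.unit⟩, PUnit.unit⟩) _ ?_
  refine IsInitial.ofUniqueHom (fun t => ⟨𝟙 _, rfl⟩) ?_
  intro t m
  apply Subtype.ext
  exact Subsingleton.elim _ _

/-- The adjunction induced by the basis of the terminal ionad. -/
def oneBasisAdj :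
    ({ obj := fun P _ => P.obj (Opposite.op ⟨PUnit.unit⟩), map := fun α _ => α.app _ } :
      ((Discrete PUnit.{u + 1})ᵒᵖ ⥤ Type u) ⥤ (PUnit.{u + 1} → Type u)) ⊣
    ({ obj := fun A => (Functor.const _).obj (A PUnit.unit),
       map := fun φ => (Functor.const _).map (φ PUnit.unit) }) where
  unit :=
    { app := fun P =>
        { app := fun c => 𝟙 (P.obj c)
          naturality := fun c d f => by
            obtain rfl : c = d := Subsingleton.elim _ _
            obtain rfl : f = 𝟙 c := Subsingleton.elim _ _
            simp }
      naturality := fun P Q α => by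
        ext c
        simp }
  counit := { app := fun A _ => 𝟙 (A PUnit.unit) }

lemma oneIonad_isBounded : oneIonad.{u}.IsBounded :=
  ⟨Discrete PUnit.{u + 1}, inferInstance, oneBasis, oneBasis_isFlat, _, _, oneBasisAdj,
    ⟨NatIso.ofComponents (fun c => Pi.isoMk fun _ =>
      Equiv.toIso (Y := PUnit)
        ⟨fun _ => PUnit.unit, fun _ => eqToHom (Subsingleton.elim _ _),
          fun k => Subsingleton.elim (α := (Opposite.unop (Opposite.op (⟨PUnit.unit⟩ :
            Discrete PUnit.{u + 1})) ⟶ c)) _ k, fun _ => rfl⟩) (fun f => by rfl)⟩,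
    ⟨ComonadIso.mk (Iso.refl (𝟭 (PUnit.{u + 1} → Type u))) (fun _ => rfl) (fun _ => rfl)⟩⟩

/-- The terminal ionad, as a bounded ionad. -/
def oneBIon : BIon.{u} := ⟨oneIonad, oneIonad_isBounded⟩

/-- The continuous map `1 ⟶ X` determined by a point `x`; its lifting is `x⁻¹ ∘ U_X`. -/
def Ionad.point (X : Ionad.{u}) (x : X.pts) : oneIonad.{u} ⟶ X :=
  { toFun := fun _ => x
    star :=
      { obj := fun P => { A := fun _ => P.A x, a := 𝟙 _ }
        map := fun φ => { f := fun _ => φ.f x } }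
    comm := rfl : Ionad.Map oneIonad X }

/-- The canonical functor from `C` to the category of points of its Alexandroff ionad: an object
goes to the corresponding point, an arrow `g` to the action of `g` on opens. -/
def alexPoints (C : Cat.{u, u}) : C ⥤ (oneBIon.{u} ⟶ alexandroff.obj C) where
  obj c := Ionad.point (alexIonad C) c
  map {c d} g :=
    { nat :=
        { app := fun P => { f := fun _ => ((opensToFunctor C).obj P).map g }
          naturality := fun P Q φ => Comonad.Coalgebra.Hom.ext
            (funext fun _ => (((opensToFunctor C).map φ).naturality g).symm) } :
      Ionad.Specialisation (Ionad.point (alexIonad C) c) (Ionad.point (alexIonad C) d) }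
  map_id c := Ionad.Specialisation.ext (NatTrans.ext (funext fun P =>
    Comonad.Coalgebra.Hom.ext (funext fun _ => ((opensToFunctor C).obj P).map_id c)))
  map_comp g h := Ionad.Specialisation.ext (NatTrans.ext (funext fun P =>
    Comonad.Coalgebra.Hom.ext (funext fun _ => ((opensToFunctor C).obj P).map_comp g h)))

/-- For `M : B ⥤ Set^X`, the functor `Cᵒᵖ × B ⥤ Set^(ob C × X)` sending `(c, b)` to the family
`(c', x) ↦ C(c, c') × M(b)(x)`. -/
def tensorBasis (C : Type u) [SmallCategory C] {X B : Type u} [SmallCategory B]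
    (M : B ⥤ (X → Type u)) : Cᵒᵖ × B ⥤ (C × X → Type u) where
  obj p := fun q => (p.1.unop ⟶ q.1) × M.obj p.2 q.2
  map f := fun q => ↾fun t => (f.1.unop ≫ t.1, M.map f.2 q.2 t.2)
  map_id p := by
    ext q t
    · exact Category.id_comp t.1
    · exact congrArg (fun k => k t.2) (congrFun (M.map_id p.2) q.2)
  map_comp f g := by
    ext q t
    · exact Category.assoc g.1.unop f.1.unop t.1
    · exact congrArg (fun k => k t.2) (congrFun (M.map_comp f.2 g.2) q.2)

/-! ### 2-categorical notions

These are used for strict bicategories, that is, 2-categories; `StrictPseudofunctor`s are the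
2-functors between them. -/

/-- A functor is an isomorphism of categories. -/
def IsCatIso {C D : Type*} [Category C] [Category D] (F : C ⥤ D) : Prop :=
  ∃ G : D ⥤ C, F ⋙ G = 𝟭 C ∧ G ⋙ F = 𝟭 D

section TwoCategories

variable {K : Type*} [Bicategory K] {L : Type*} [Bicategory L]

/-- Precomposition with `η : C ⥤ K(X, T)` turns an arrow `T ⟶ Y` into a functor `C ⥤ K(X, Y)`. -/
def tensorComparison {C : Type*} [Category C] {X T : K} (η : C ⥤ (X ⟶ T)) (Y : K) :
    (T ⟶ Y) ⥤ (C ⥤ (X ⟶ Y)) :=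
  postcomposing X T Y ⋙ (Functor.whiskeringLeft C (X ⟶ T) (X ⟶ Y)).obj η

/-- `η : C ⥤ K(X, T)` exhibits `T` as the tensor `C ⊗ X`: it induces isomorphisms of categories
`K(T, Y) ≅ [C, K(X, Y)]` (which are automatically 2-natural in `Y`). -/
def IsTensor {C : Type*} [Category C] {X T : K} (η : C ⥤ (X ⟶ T)) : Prop :=
  ∀ Y : K, IsCatIso (tensorComparison η Y)

/-- `p` and `q` exhibit `P` as the (2-categorical) product of `X` and `Y`: they induce isomorphisms
of categories `K(Z, P) ≅ K(Z, X) × K(Z, Y)`. -/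
def IsProduct {P X Y : K} (p : P ⟶ X) (q : P ⟶ Y) : Prop :=
  ∀ Z : K, IsCatIso (Functor.prod' (postcomp Z p) (postcomp Z q))

/-- 2-natural transformations between 2-functors. -/
structure TwoNatTrans (F G : StrictPseudofunctor K L) where
  app : ∀ X : K, F.obj X ⟶ G.obj X
  naturality : ∀ {X Y : K} (f : X ⟶ Y), F.map f ≫ app Y = app X ≫ G.map f
  naturality₂ : ∀ {X Y : K} {f g : X ⟶ Y} (θ : f ⟶ g),
    F.map₂ θ ▷ app Y ≫ eqToHom (naturality g) = eqToHom (naturality f) ≫ app X ◁ G.map₂ θ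

/-- 2-natural isomorphisms between 2-functors. -/
structure TwoNatIso (F G : StrictPseudofunctor K L) where
  hom : TwoNatTrans F G
  inv : TwoNatTrans G F
  hom_inv : ∀ X : K, hom.app X ≫ inv.app X = 𝟙 (F.obj X)
  inv_hom : ∀ X : K, inv.app X ≫ hom.app X = 𝟙 (G.obj X)

/-- A 2-adjunction `F ⊣ G` between 2-functors: 2-natural unit and counit which satisfy the triangle
identities strictly. -/
structure TwoAdjunction (F : StrictPseudofunctor K L) (G : StrictPseudofunctor L K) where
  unit : TwoNatTrans (StrictPseudofunctor.id K) (F.comp G)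
  counit : TwoNatTrans (G.comp F) (StrictPseudofunctor.id L)
  left_triangle : ∀ X : K, F.map (unit.app X) ≫ counit.app (F.obj X) = 𝟙 (F.obj X)
  right_triangle : ∀ Y : L, unit.app (G.obj Y) ≫ G.map (counit.app Y) = 𝟙 (G.obj Y)

/-- The 2-functor `(–) ⊗ X : Cat ⥤ K`: a 2-functor `T` with 2-natural units
`unit C : C ⥤ K(X, T C)` which exhibit each `T C` as the tensor `C ⊗ X`. -/
structure TensorFunctor (X : K) where
  functor : StrictPseudofunctor Cat.{u, u} K
  unit : ∀ C : Cat.{u, u}, C ⥤ (X ⟶ functor.obj C)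
  isTensor : ∀ C : Cat.{u, u}, IsTensor (unit C)
  naturality : ∀ {C D : Cat.{u, u}} (F : C ⟶ D),
    F.toFunctor ⋙ unit D = unit C ⋙ postcomp X (functor.map F)
  naturality₂ : ∀ {C D : Cat.{u, u}} {F G : C ⟶ D} (α : F ⟶ G),
    Functor.whiskerRight α.toNatTrans (unit D) ≫ eqToHom (naturality G) =
      eqToHom (naturality F) ≫
        Functor.whiskerLeft (unit C) ((postcomposing X _ _).map (functor.map₂ α))

/-- A 2-functor `V : K ⥤ Cat` into small categories together with isomorphisms of categories
`V Y ≅ K(X, Y)`, 2-natural in `Y`. As the categories `K(X, Y)` are allowed to live in a larger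
universe, this says that `K(X, –)` takes values in small categories, and that `V` is the
representable 2-functor `K(X, –)`. -/
structure SmallRepresentable (X : K) where
  functor : StrictPseudofunctor K Cat.{u, u}
  iso : ∀ Y : K, functor.obj Y ⥤ (X ⟶ Y)
  isIso : ∀ Y : K, IsCatIso (iso Y)
  naturality : ∀ {Y Z : K} (f : Y ⟶ Z),
    (functor.map f).toFunctor ⋙ iso Z = iso Y ⋙ postcomp X f
  naturality₂ : ∀ {Y Z : K} {f g : Y ⟶ Z} (θ : f ⟶ g),
    Functor.whiskerRight (functor.map₂ θ).toNatTrans (iso Z) ≫ eqToHom (naturality g) =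
      eqToHom (naturality f) ≫ Functor.whiskerLeft (iso Y) ((postcomposing X Y Z).map θ)

end TwoCategories

/-! ### Isomorphisms of categories -/

section CatIso

variable {C D E : Type*} [Category C] [Category D] [Category E]

/-! A functor `C ⥤ (X ⟶ Y)` amounts to a function from `C × X` to the points of `Y` and, after
exchanging variables, a compatible functor from the opens of `Y` to diagrams of opens of `X`. So an
ionad on `C × X` whose opens are, strictly, the diagrams `C ⥤ X.Opens` is the tensor
(`IsTensor.of_opens`). Forgetting coalgebra structures and then the action of arrows takes such
diagrams to families on `C × X`. This functor has a right adjoint and is strictly comonadic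
(`toTensorOpens_isCatIso`), and its comonad is the one wanted. If `M` generates `X`, the adjunction
of `M`, applied pointwise over `C` and combined with currying of presheaves, induces the same
comonad. Its left adjoint sends representables to `tensorBasis C M`, because left adjoints preserve
copowers (`generates_tensorBasis`).

For the product, an element of a diagram of opens `Q` at `(c, x)` lies in the image of the copower
of `Q.obj c` by `C(c, –)`. This copower is the product of a diagram of constant opens and a constant
diagram, which are pulled back from `A(C)` and from `X` respectively. A functor `H` preserving
finite limits respects the product. Hence natural transformations from underlying families of
diagrams into `H` of such families correspond to arbitrary pairs of transformations on the two
special kinds of diagrams (`diagramFam_natTrans_ext`, `exists_diagramFam_natTrans`). Taking for `H`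
the identity, the interior comonad of the source and its square handles specialisations, coalgebra
structures and coassociativity.

Since opens of `1` are sets, the same criterion exhibits `A(C)` as `C ⊗ 1` (`isTensor_alexPoints`).
Uniqueness of tensor 2-functors and the 2-adjunctions are then formal. Smallness of `V` uses
boundedness: a specialisation between points is determined by its values on the opens coming from a
basis (`Ionad.small_specialisation`). -/

lemma IsCatIso.of_bijective (F : C ⥤ D) [F.Full] [F.Faithful]
    (h : Function.Bijective F.obj) : IsCatIso F := by
  obtain ⟨g, hg₁, hg₂⟩ := Function.bijective_iff_has_inverse.mp h
  let G : D ⥤ C :=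
    { obj := g
      map := fun {X Y} f => F.preimage (eqToHom (hg₂ X) ≫ f ≫ eqToHom (hg₂ Y).symm)
      map_id := fun X => F.map_injective (by simp)
      map_comp := fun f f' => F.map_injective (by simp) }
  refine ⟨G, CategoryTheory.Functor.ext hg₁ fun X Y f => F.map_injective ?_,
    CategoryTheory.Functor.ext hg₂ fun X Y f => ?_⟩
  · simp [G, eqToHom_map]
  · simp [G]

lemma IsCatIso.comp {F : C ⥤ D} {G : D ⥤ E} (hF : IsCatIso F) (hG : IsCatIso G) :
    IsCatIso (F ⋙ G) := by
  obtain ⟨F', h₁, h₂⟩ := hF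
  obtain ⟨G', h₃, h₄⟩ := hG
  refine ⟨G' ⋙ F', ?_, ?_⟩
  · rw [Functor.assoc, ← Functor.assoc G, h₃, Functor.id_comp, h₁]
  · rw [Functor.assoc, ← Functor.assoc F', h₂, Functor.id_comp, h₄]

lemma IsCatIso.isEquivalence {F : C ⥤ D} (h : IsCatIso F) : F.IsEquivalence := by
  obtain ⟨G, h₁, h₂⟩ := h
  exact (CategoryTheory.Equivalence.mk F G (eqToIso h₁.symm) (eqToIso h₂)).isEquivalence_functor

lemma IsCatIso.bijective_obj {F : C ⥤ D} (h : IsCatIso F) : Function.Bijective F.obj := by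
  obtain ⟨G, h₁, h₂⟩ := h
  exact Function.bijective_iff_has_inverse.mpr
    ⟨G.obj, Functor.congr_obj h₁, Functor.congr_obj h₂⟩

lemma IsCatIso.cancel_right {F : D ⥤ E} (h : IsCatIso F) {G G' : C ⥤ D}
    (e : G ⋙ F = G' ⋙ F) : G = G' := by
  obtain ⟨F', h₁, -⟩ := h
  rw [← G.comp_id, ← G'.comp_id, ← h₁, ← Functor.assoc, e, Functor.assoc]

lemma IsCatIso.heq_of_whiskerRight {F : D ⥤ E} (h : IsCatIso F) {G₁ G₁' G₂ G₂' : C ⥤ D}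
    (e₁ : G₁ = G₁') (e₂ : G₂ = G₂') {α : G₁ ⟶ G₂} {α' : G₁' ⟶ G₂'}
    (e : Functor.whiskerRight α F ≍ Functor.whiskerRight α' F) : α ≍ α' := by
  subst e₁ e₂
  have := h.isEquivalence
  refine heq_of_eq (NatTrans.ext (funext fun X => F.map_injective ?_))
  exact NatTrans.congr_app (eq_of_heq e) X

/-- The 2-dimensional naturality conditions hold between 1-cells that are only propositionally
equal. Heterogeneous equality removes the `eqToHom`s, so that such conditions can be chained by
transitivity. -/
lemma comp_eqToHom_eq_iff_heq {X Y X' Y' : C} {f : X ⟶ Y} {g : X' ⟶ Y'} (h : Y = Y') (h' : X = X') :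
    f ≫ eqToHom h = eqToHom h' ≫ g ↔ f ≍ g := by
  subst h h'
  simp

lemma NatTrans.heq_app {F F' G G' : C ⥤ D} (e : F = F') (e' : G = G') {α : F ⟶ G}
    {α' : F' ⟶ G'} (h : α ≍ α') (X : C) : α.app X ≍ α'.app X := by
  subst e e' h
  rfl

lemma NatTrans.heq_of_app {F F' G G' : C ⥤ D} (e : F = F') (e' : G = G') {α : F ⟶ G}
    {α' : F' ⟶ G'} (h : ∀ X, α.app X ≍ α'.app X) : α ≍ α' := by
  subst e e'
  exact heq_of_eq (NatTrans.ext (funext fun X => eq_of_heq (h X)))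

end CatIso

lemma CategoryTheory.Cat.heq_of_toNatTrans {C D : Cat.{u, u}} {F F' G G' : C ⟶ D} (e : F = F')
    (e' : G = G') {α : F ⟶ G} {α' : F' ⟶ G'} (h : α.toNatTrans ≍ α'.toNatTrans) : α ≍ α' := by
  subst e e'
  exact heq_of_eq (Cat.Hom₂.ext (eq_of_heq h))

/-! ### The universal property of tensors in `BIon` -/

namespace IsTensor

variable {C : Type*} [Category C] {X T : BIon.{u}} {η : C ⥤ (X ⟶ T)}

lemma exists_fac (h : IsTensor η) {Y : BIon.{u}} (H : C ⥤ (X ⟶ Y)) :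
    ∃ k : T ⟶ Y, η ⋙ postcomp X k = H :=
  (h Y).bijective_obj.2 H

noncomputable def desc (h : IsTensor η) {Y : BIon.{u}} (H : C ⥤ (X ⟶ Y)) : T ⟶ Y :=
  (h.exists_fac H).choose

lemma fac (h : IsTensor η) {Y : BIon.{u}} (H : C ⥤ (X ⟶ Y)) :
    η ⋙ postcomp X (h.desc H) = H :=
  (h.exists_fac H).choose_spec

lemma hom_ext (h : IsTensor η) {Y : BIon.{u}} {k k' : T ⟶ Y}
    (e : η ⋙ postcomp X k = η ⋙ postcomp X k') : k = k' :=
  (h Y).bijective_obj.1 e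

/-- The 2-dimensional half of uniqueness: the comparison functor is faithful. -/
lemma hom₂_heq (h : IsTensor η) {Y : BIon.{u}} {k k' l l' : T ⟶ Y} (e : k = k') (e' : l = l')
    {θ : k ⟶ l} {θ' : k' ⟶ l'} (H : ∀ c, η.obj c ◁ θ ≍ η.obj c ◁ θ') : θ ≍ θ' := by
  subst e e'
  have := (h Y).isEquivalence
  refine heq_of_eq ((tensorComparison η Y).map_injective
    (NatTrans.ext (funext fun c => eq_of_heq (H c))))

end IsTensor

lemma BIon.whiskerRight_heq {X Y Z : BIon.{u}} {f f' g g' : X ⟶ Y} (e : f = f') (e' : g = g')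
    {θ : f ⟶ g} {θ' : f' ⟶ g'} (h : θ ≍ θ') (k : Y ⟶ Z) : θ ▷ k ≍ θ' ▷ k := by
  subst e e' h
  rfl

lemma BIon.whiskerLeft_heq {X Y Z : BIon.{u}} {f f' : X ⟶ Y} (e : f = f') {g g' : Y ⟶ Z}
    (θ : g ⟶ g') : f ◁ θ ≍ f' ◁ θ := by
  subst e
  rfl

/-! ### Uniqueness of the tensor 2-functor -/

namespace TensorFunctor

variable {X : BIon.{u}}

lemma unit_map_heq (S : TensorFunctor.{u} X) {C D : Cat.{u, u}} {F G : C ⟶ D} (α : F ⟶ G) (c : C) :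
    (S.unit D).map (α.toNatTrans.app c) ≍ (S.unit C).obj c ◁ S.functor.map₂ α :=
  NatTrans.heq_app (S.naturality F) (S.naturality G)
    ((comp_eqToHom_eq_iff_heq _ _).mp (S.naturality₂ α)) c

/-- The comparison 2-natural transformation between two tensor 2-functors. -/
noncomputable def comparison (S T : TensorFunctor.{u} X) : TwoNatTrans S.functor T.functor :=
  have nat : ∀ {C D : Cat.{u, u}} (F : C ⟶ D),
      S.functor.map F ≫ (S.isTensor D).desc (T.unit D) =
        (S.isTensor C).desc (T.unit C) ≫ T.functor.map F := fun {C D} F => by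
    refine (S.isTensor C).hom_ext ?_
    change (S.unit C ⋙ postcomp X (S.functor.map F)) ⋙ postcomp X _ =
      (S.unit C ⋙ postcomp X _) ⋙ postcomp X _
    rw [← S.naturality, Functor.assoc, IsTensor.fac, IsTensor.fac, T.naturality]
  { app := fun C => (S.isTensor C).desc (T.unit C)
    naturality := nat
    naturality₂ := fun {C D F G} θ => by
      rw [comp_eqToHom_eq_iff_heq]
      refine (S.isTensor C).hom₂_heq (nat F) (nat G) fun c => ?_
      change ((S.unit C).obj c ◁ S.functor.map₂ θ) ▷ (S.isTensor D).desc (T.unit D) ≍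
        ((S.unit C).obj c ≫ (S.isTensor C).desc (T.unit C)) ◁ T.functor.map₂ θ
      -- Naturality of `S.unit` rewrites the inner whiskering as `S.unit D` at the component of `θ`,
      -- the factorisation turns `S.unit D` into `T.unit D`, and naturality of `T.unit` brings the
      -- component back to `T.functor.map₂ θ`.
      refine (BIon.whiskerRight_heq (Functor.congr_obj (S.naturality F) c).symm
        (Functor.congr_obj (S.naturality G) c).symm (S.unit_map_heq θ c).symm _).trans ?_
      refine (Functor.hcongr_hom ((S.isTensor D).fac (T.unit D)) (θ.toNatTrans.app c)).trans ?_
      refine (T.unit_map_heq θ c).trans ?_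
      exact BIon.whiskerLeft_heq (Functor.congr_obj ((S.isTensor C).fac (T.unit C)) c).symm _ }

lemma unit_comparison (S T : TensorFunctor.{u} X) (C : Cat.{u, u}) :
    S.unit C ⋙ postcomp X ((S.comparison T).app C) = T.unit C :=
  (S.isTensor C).fac _

lemma comparison_comp (S T : TensorFunctor.{u} X) (C : Cat.{u, u}) :
    (S.comparison T).app C ≫ (T.comparison S).app C = 𝟙 _ := by
  refine (S.isTensor C).hom_ext ?_
  change (S.unit C ⋙ postcomp X _) ⋙ postcomp X _ = S.unit C
  rw [unit_comparison, unit_comparison]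

/-- Any two tensor 2-functors are 2-naturally isomorphic. -/
noncomputable def uniqueUpToIso (S T : TensorFunctor.{u} X) : TwoNatIso S.functor T.functor where
  hom := S.comparison T
  inv := T.comparison S
  hom_inv := S.comparison_comp T
  inv_hom := T.comparison_comp S

end TensorFunctor

/-! ### Tensors are left 2-adjoint to representables -/

namespace SmallRepresentable

variable {X : BIon.{u}} (V : SmallRepresentable.{u} X)

noncomputable def isoInv (Y : BIon.{u}) : (X ⟶ Y) ⥤ V.functor.obj Y := (V.isIso Y).choose

lemma isoInv_iso (Y : BIon.{u}) : V.isoInv Y ⋙ V.iso Y = 𝟭 _ := (V.isIso Y).choose_spec.2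

lemma map_heq {Y Z : BIon.{u}} {f g : Y ⟶ Z} (θ : f ⟶ g) (y : V.functor.obj Y) :
    (V.iso Z).map ((V.functor.map₂ θ).toNatTrans.app y) ≍ (V.iso Y).obj y ◁ θ :=
  NatTrans.heq_app (V.naturality f) (V.naturality g)
    ((comp_eqToHom_eq_iff_heq _ _).mp (V.naturality₂ θ)) y

variable (T : TensorFunctor.{u} X)

noncomputable def adjUnitApp (C : Cat.{u, u}) : C ⟶ V.functor.obj (T.functor.obj C) :=
  ⟨T.unit C ⋙ V.isoInv (T.functor.obj C)⟩

lemma adjUnitApp_iso (C : Cat.{u, u}) :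
    (V.adjUnitApp T C).toFunctor ⋙ V.iso (T.functor.obj C) = T.unit C := by
  change (T.unit C ⋙ V.isoInv (T.functor.obj C)) ⋙ V.iso (T.functor.obj C) = _
  rw [Functor.assoc, isoInv_iso, Functor.comp_id]

noncomputable def adjUnit : TwoNatTrans (StrictPseudofunctor.id Cat.{u, u})
    (T.functor.comp V.functor) :=
  have nat : ∀ {C D : Cat.{u, u}} (F : C ⟶ D), F ≫ V.adjUnitApp T D =
      V.adjUnitApp T C ≫ V.functor.map (T.functor.map F) := fun {C D} F => by
    refine Cat.ext ((V.isIso _).cancel_right ?_)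
    rw [Cat.Hom.comp_toFunctor, Cat.Hom.comp_toFunctor, Functor.assoc, Functor.assoc,
      adjUnitApp_iso, V.naturality, ← Functor.assoc, adjUnitApp_iso, T.naturality]
  { app := V.adjUnitApp T
    naturality := nat
    naturality₂ := fun {C D F G} θ => by
      refine (comp_eqToHom_eq_iff_heq (nat G) (nat F)).mpr ?_
      refine Cat.heq_of_toNatTrans (nat F) (nat G) ?_
      refine (V.isIso _).heq_of_whiskerRight (congrArg Cat.Hom.toFunctor (nat F))
        (congrArg Cat.Hom.toFunctor (nat G)) ?_
      refine NatTrans.heq_of_app (congrArg (fun k => Cat.Hom.toFunctor k ⋙ V.iso _) (nat F))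
        (congrArg (fun k => Cat.Hom.toFunctor k ⋙ V.iso _) (nat G)) fun c => ?_
      refine (Functor.hcongr_hom (V.adjUnitApp_iso T D) (θ.toNatTrans.app c)).trans ?_
      refine (T.unit_map_heq θ c).trans ?_
      refine HEq.trans ?_ (V.map_heq (T.functor.map₂ θ) ((V.adjUnitApp T C).toFunctor.obj c)).symm
      exact BIon.whiskerLeft_heq (Functor.congr_obj (V.adjUnitApp_iso T C) c).symm _ }

noncomputable def adjCounitApp (Y : BIon.{u}) : T.functor.obj (V.functor.obj Y) ⟶ Y :=
  (T.isTensor _).desc (V.iso Y)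

lemma unit_adjCounitApp (Y : BIon.{u}) :
    T.unit (V.functor.obj Y) ⋙ postcomp X (V.adjCounitApp T Y) = V.iso Y :=
  (T.isTensor _).fac (V.iso Y)

noncomputable def adjCounit : TwoNatTrans (V.functor.comp T.functor)
    (StrictPseudofunctor.id BIon.{u}) :=
  have nat : ∀ {Y Z : BIon.{u}} (f : Y ⟶ Z), T.functor.map (V.functor.map f) ≫ V.adjCounitApp T Z =
      V.adjCounitApp T Y ≫ f := fun {Y Z} f => by
    refine (T.isTensor _).hom_ext ?_
    change (T.unit _ ⋙ postcomp X (T.functor.map _)) ⋙ postcomp X _ =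
      (T.unit _ ⋙ postcomp X _) ⋙ postcomp X f
    rw [← T.naturality, Functor.assoc, unit_adjCounitApp, unit_adjCounitApp, V.naturality]
  { app := V.adjCounitApp T
    naturality := nat
    naturality₂ := fun {Y Z f g} θ => by
      refine (comp_eqToHom_eq_iff_heq (nat g) (nat f)).mpr ?_
      refine (T.isTensor _).hom₂_heq (nat f) (nat g) fun c => ?_
      change ((T.unit _).obj c ◁ T.functor.map₂ (V.functor.map₂ θ)) ▷ V.adjCounitApp T Z ≍
        ((T.unit _).obj c ≫ V.adjCounitApp T Y) ◁ θ
      refine (BIon.whiskerRight_heq (Functor.congr_obj (T.naturality (V.functor.map f)) c).symm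
        (Functor.congr_obj (T.naturality (V.functor.map g)) c).symm
        (T.unit_map_heq (V.functor.map₂ θ) c).symm _).trans ?_
      refine (Functor.hcongr_hom (V.unit_adjCounitApp T Z) _).trans ?_
      refine (V.map_heq θ c).trans ?_
      exact BIon.whiskerLeft_heq (Functor.congr_obj (V.unit_adjCounitApp T Y) c).symm _ }

/-- The 2-functor of tensors with `X` is left 2-adjoint to the one represented by `X`. -/
noncomputable def adjunction : TwoAdjunction T.functor V.functor where
  unit := V.adjUnit T
  counit := V.adjCounit T
  left_triangle C := by
    refine (T.isTensor C).hom_ext ?_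
    change (T.unit C ⋙ postcomp X (T.functor.map (V.adjUnitApp T C))) ⋙
      postcomp X (V.adjCounitApp T _) = T.unit C
    rw [← T.naturality, Functor.assoc, unit_adjCounitApp, adjUnitApp_iso]
  right_triangle Y := by
    refine Cat.ext ((V.isIso _).cancel_right ?_)
    change (V.adjUnitApp T (V.functor.obj Y)).toFunctor ⋙
      (V.functor.map (V.adjCounitApp T Y)).toFunctor ⋙ V.iso Y = V.iso Y
    rw [V.naturality, ← Functor.assoc, adjUnitApp_iso, unit_adjCounitApp]

end SmallRepresentable

/-! ### A criterion for tensors -/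

/-- Objects and arrows of `S → Type u` are families, so equality can be tested at each point, and
every point is hit by some `f i`. -/
lemma functor_eq_of_pullFam {E : Type*} [Category E] {S : Type u} {F G : E ⥤ (S → Type u)}
    {ι : Type*} {R : ι → Type u} (f : ∀ i, R i → S) (hf : ∀ s, ∃ i r, f i r = s)
    (h : ∀ i, F ⋙ pullFam (f i) = G ⋙ pullFam (f i)) : F = G := by
  have hobj : ∀ X, F.obj X = G.obj X := fun X => funext fun s => by
    obtain ⟨i, r, rfl⟩ := hf s
    exact congrFun (Functor.congr_obj (h i) X) r
  refine Functor.hext hobj fun X Y m => ?_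
  refine Function.hfunext rfl fun s s' hs => ?_
  obtain rfl := eq_of_heq hs
  obtain ⟨i, r, rfl⟩ := hf s
  have := Functor.hcongr_hom (h i) m
  have hX := hobj X
  have hY := hobj Y
  -- The arrows are generalised so that the equal source and target families can be rewritten
  -- without dependent-type obstructions.
  revert this
  change (fun r => F.map m (f i r)) ≍ (fun r => G.map m (f i r)) → _
  generalize F.map m = a
  generalize G.map m = b
  revert a b
  rw [hX, hY]
  intro a b hab
  exact heq_of_eq (congrFun (eq_of_heq hab) r)

namespace Ionad

/-- The functor sending a continuous map to its action on opens. -/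
@[simps]
def starFunctor (X Y : Ionad.{u}) : (X ⟶ Y) ⥤ (Y.Opens ⥤ X.Opens) where
  obj f := Map.star f
  map a := Specialisation.nat a

lemma functor_ext {C : Type*} [Category C] {X Y : Ionad.{u}} {H H' : C ⥤ (X ⟶ Y)}
    (h : ∀ c, Map.toFun (H.obj c) = Map.toFun (H'.obj c))
    (h' : H ⋙ starFunctor X Y = H' ⋙ starFunctor X Y) : H = H' := by
  refine CategoryTheory.Functor.ext (fun c => Map.ext (h c) (Functor.congr_obj h' c)) fun c d g => ?_
  refine hom₂_ext ?_
  rw [comp_nat, comp_nat, eqToHom_nat, eqToHom_nat]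
  exact Functor.congr_hom h' g

end Ionad

open Ionad in
-- Exchanging variables turns restriction along `η` into postcomposition with the isomorphism
-- `hstar` on the liftings, while `hpts` glues the underlying functions.
theorem IsTensor.of_opens {C : Type*} [Category C] {X T : BIon.{u}} (η : C ⥤ (X ⟶ T))
    (hpts : Function.Bijective fun p : C × X.ion.pts => Map.toFun (η.obj p.1) p.2)
    (hstar : IsCatIso (η ⋙ starFunctor X.ion T.ion).flip) : IsTensor η := by
  intro Y
  have := hstar.isEquivalence
  have key : ∀ k : T ⟶ Y, ((tensorComparison η Y).obj k ⋙ starFunctor X.ion Y.ion).flip =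
      Map.star k ⋙ (η ⋙ starFunctor X.ion T.ion).flip := fun k => rfl
  have : (tensorComparison η Y).Faithful := ⟨fun {k l} a b hab => by
    refine hom₂_ext ?_
    refine ((Functor.whiskeringRight _ _ _).obj
      (η ⋙ starFunctor X.ion T.ion).flip).map_injective ?_
    refine NatTrans.ext (funext fun P => NatTrans.ext (funext fun c => ?_))
    exact NatTrans.congr_app (congrArg Specialisation.nat (NatTrans.congr_app hab c)) P⟩
  have : (tensorComparison η Y).Full := ⟨fun {k l} γ => by
    let γ' : Map.star k ⋙ (η ⋙ starFunctor X.ion T.ion).flip ⟶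
        Map.star l ⋙ (η ⋙ starFunctor X.ion T.ion).flip :=
      (flipFunctor _ _ _).map (Functor.whiskerRight γ (starFunctor X.ion Y.ion))
    obtain ⟨θ, hθ⟩ := ((Functor.whiskeringRight _ _ _).obj
      (η ⋙ starFunctor X.ion T.ion).flip).map_surjective γ'
    refine ⟨(⟨θ⟩ : Specialisation k l), NatTrans.ext (funext fun c => hom₂_ext ?_)⟩
    refine NatTrans.ext (funext fun P => ?_)
    exact NatTrans.congr_app (NatTrans.congr_app hθ P) c⟩
  refine IsCatIso.of_bijective _ ⟨fun k l hkl => ?_, fun H => ?_⟩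
  · refine Map.ext (funext fun t => ?_) (hstar.cancel_right ?_)
    · obtain ⟨⟨c, x⟩, rfl⟩ := hpts.2 t
      exact congrFun (congrArg Map.toFun (Functor.congr_obj hkl c)) x
    · rw [← key, ← key, hkl]
  · obtain ⟨e, he₁, he₂⟩ := Function.bijective_iff_has_inverse.mp hpts
    obtain ⟨Γ, hΓ₁, hΓ₂⟩ := hstar
    let φ : T.ion.pts → Y.ion.pts := fun t => Map.toFun (H.obj (e t).1) (e t).2
    have hφ : ∀ c x, φ (Map.toFun (η.obj c) x) = Map.toFun (H.obj c) x := fun c x => by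
      have := he₁ (c, x)
      simp only [φ]
      dsimp only at this
      rw [this]
    let S : Y.ion.Opens ⥤ T.ion.Opens := (H ⋙ starFunctor X.ion Y.ion).flip ⋙ Γ
    have hS : S ⋙ (η ⋙ starFunctor X.ion T.ion).flip = (H ⋙ starFunctor X.ion Y.ion).flip := by
      rw [Functor.assoc, hΓ₂, Functor.comp_id]
    have hc : ∀ c, S ⋙ Map.star (η.obj c) = Map.star (H.obj c) := fun c =>
      congrArg (fun K => K ⋙ (evaluation _ _).obj c) hS
    let k : Map T.ion Y.ion :=
      { toFun := φ
        star := S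
        comm := by
          -- The copies of `X` indexed by `C` jointly cover the points of `T`, so compatibility with
          -- `φ` is inherited from each `H.obj c`.
          refine functor_eq_of_pullFam (fun c => Map.toFun (η.obj c)) (fun t => ⟨_, _, he₂ t⟩) fun c => ?_
          · rw [Functor.assoc, ← (η.obj c).comm, ← Functor.assoc, hc, (H.obj c).comm]
            have : Map.toFun (H.obj c) = fun x => φ (Map.toFun (η.obj c) x) :=
              funext fun x => (hφ c x).symm
            rw [this]
            rfl }
    refine ⟨k, functor_ext (fun c => funext fun x => hφ c x) ?_⟩
    exact congrArg Functor.flip hS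

/-! ### The Alexandroff embedding as a tensor 2-functor -/

/-- For the identity comonad the counit law forces the structure map to be the identity. -/
lemma oneIonad_opens_ext {P Q : oneIonad.{u}.Opens} (h : P.A = Q.A) : P = Q := by
  revert h
  obtain ⟨A, a, ha, -⟩ := P
  obtain ⟨B, b, hb, -⟩ := Q
  rintro (rfl : A = B)
  have h₁ : a = 𝟙 _ := (Category.comp_id _).symm.trans ha
  have h₂ : b = 𝟙 _ := (Category.comp_id _).symm.trans hb
  subst h₁ h₂
  rfl

/-- The opens of the terminal ionad are sets. -/
def setToOneOpens : Type u ⥤ oneIonad.{u}.Opens where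
  obj S := { A := fun _ => S, a := 𝟙 _ }
  map f := { f := fun _ => f }

def oneOpensToSet : oneIonad.{u}.Opens ⥤ Type u where
  obj P := P.A PUnit.unit
  map f := f.f PUnit.unit

lemma oneOpensToSet_setToOneOpens : oneOpensToSet.{u} ⋙ setToOneOpens = 𝟭 _ := by
  refine Functor.hext (fun P => oneIonad_opens_ext rfl) fun P Q f => ?_
  have key : ∀ {P P' Q Q' : oneIonad.{u}.Opens} (_ : P = P') (_ : Q = Q') (f : P ⟶ Q)
    (g : P' ⟶ Q'), f.f ≍ g.f → f ≍ g := by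
    rintro P _ Q _ rfl rfl f g h
    exact heq_of_eq (Comonad.Coalgebra.Hom.ext (eq_of_heq h))
  exact @key ((oneOpensToSet ⋙ setToOneOpens).obj P) P ((oneOpensToSet ⋙ setToOneOpens).obj Q) Q
    (oneIonad_opens_ext rfl) (oneIonad_opens_ext rfl) _ f HEq.rfl

/-- On opens, the flipped family of points is the identification of coalgebras with functors to
sets, followed by that of sets with opens of `1`. -/
lemma isTensor_alexPoints (C : Cat.{u, u}) : IsTensor (alexPoints C) := by
  refine IsTensor.of_opens _ ⟨fun p q h => Prod.ext h rfl, fun c => ⟨(c, PUnit.unit), rfl⟩⟩ ?_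
  refine ⟨(Functor.whiskeringRight C _ _).obj oneOpensToSet ⋙ functorToOpens C, rfl, ?_⟩
  exact congrArg (fun K => (Functor.whiskeringRight C _ _).obj K) oneOpensToSet_setToOneOpens

/-- The Alexandroff embedding is a 2-functor of tensors with the terminal ionad. -/
def alexTensorFunctor : TensorFunctor.{u} oneBIon.{u} where
  functor := alexandroff
  unit := alexPoints
  isTensor := isTensor_alexPoints
  naturality _ := rfl
  naturality₂ α := by
    refine (comp_eqToHom_eq_iff_heq _ _).mpr (heq_of_eq ?_)
    rfl

/-! ### Functors into categories of coalgebras -/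

namespace CategoryTheory.Comonad

variable {D E : Type*} [Category D] [Category E] {G : Comonad D}

/-- A natural coalgebra structure on the values of a functor lifts it to coalgebras. -/
@[simps]
def liftCoalgebra (K : E ⥤ D) (a : K ⟶ K ⋙ G.toFunctor)
    (h₁ : ∀ e, a.app e ≫ G.ε.app (K.obj e) = 𝟙 _)
    (h₂ : ∀ e, a.app e ≫ G.δ.app (K.obj e) = a.app e ≫ G.map (a.app e)) : E ⥤ G.Coalgebra where
  obj e := { A := K.obj e, a := a.app e, counit := h₁ e, coassoc := h₂ e }
  map f := { f := K.map f, h := (a.naturality f).symm }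

/-- This trades an equation between functors for a natural coalgebra structure on a fixed `K`, so
that continuous maps can be handled through natural transformations alone. -/
lemma exists_eq_liftCoalgebra {S : E ⥤ G.Coalgebra} {K : E ⥤ D} (h : S ⋙ G.forget = K) :
    ∃ a h₁ h₂, S = liftCoalgebra K a h₁ h₂ := by
  subst h
  exact ⟨{ app := fun e => (S.obj e).a, naturality := fun _ _ f => (S.map f).h.symm },
    fun e => (S.obj e).counit, fun e => (S.obj e).coassoc, rfl⟩

lemma liftCoalgebra_congr {K K' : E ⥤ D} {a : K ⟶ K ⋙ G.toFunctor} {h₁ h₂}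
    {a' : K' ⟶ K' ⋙ G.toFunctor} {h₁' h₂'} (hK : K = K') (ha : ∀ e, a.app e ≍ a'.app e) :
    liftCoalgebra K a h₁ h₂ = liftCoalgebra K' a' h₁' h₂' := by
  subst hK
  obtain rfl : a = a' := NatTrans.ext (funext fun e => eq_of_heq (ha e))
  rfl

lemma Coalgebra.a_heq {P Q : G.Coalgebra} (h : P = Q) : P.a ≍ Q.a := by
  subst h
  rfl

/-- The cofree adjunction, with the structure maps and the counit of the comonad as its unit and
counit. -/
def forgetCofreeAdj (G : Comonad D) : G.forget ⊣ G.cofree where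
  unit :=
    { app := fun P => { f := P.a, h := P.coassoc.symm }
      naturality := fun _ _ f => Coalgebra.Hom.ext f.h.symm }
  counit := { app := fun A => G.ε.app A, naturality := fun _ _ f => G.ε.naturality f }
  left_triangle_components P := P.counit
  right_triangle_components A := Coalgebra.Hom.ext (G.right_counit A)

end CategoryTheory.Comonad

lemma Pi.hasLimits_types (X : Type u) : HasLimits (X → Type u) :=
  ⟨fun _ _ => ⟨fun _ => pi.hasLimit_of_hasLimit_comp_eval⟩⟩

/-! ### Kan extension of families along the inclusion of objects -/

section Families

variable (C : Type u) [SmallCategory C] (X : Type u)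

/-- Restriction of functors `C ⥤ Set^X` to the objects of `C`. -/
@[simps]
def famOb : (C ⥤ (X → Type u)) ⥤ (C × X → Type u) where
  obj F := fun p => F.obj p.1 p.2
  map α := fun p => α.app p.1 p.2

/-- Right Kan extension of families along the inclusion of objects. -/
@[simps]
def famRan : (C × X → Type u) ⥤ (C ⥤ (X → Type u)) where
  obj A :=
    { obj := fun c x => ∀ d : C, (c ⟶ d) → A (d, x)
      map := fun g x => ↾fun φ d h => φ d (g ≫ h) }
  map α := { app := fun c x => ↾fun φ d h => α (d, x) (φ d h) }

/-- Left Kan extension of families along the inclusion of objects. -/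
@[simps]
def famLan : (C × X → Type u) ⥤ (C ⥤ (X → Type u)) where
  obj A :=
    { obj := fun c x => Σ d : C, (d ⟶ c) × A (d, x)
      map := fun g x => ↾fun t => ⟨t.1, t.2.1 ≫ g, t.2.2⟩ }
  map α := { app := fun c x => ↾fun t => ⟨t.1, t.2.1, α (t.1, x) t.2.2⟩ }

lemma Pi.map_comp_apply {X : Type u} {D : Type*} [Category D] (F : D ⥤ (X → Type u)) {a b c : D}
    (f : a ⟶ b) (g : b ⟶ c) (x : X) (e : F.obj a x) :
    F.map (f ≫ g) x e = F.map g x (F.map f x e) :=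
  congrArg (fun k => k e) (congrFun (F.map_comp f g) x)

lemma Pi.map_id_apply {X : Type u} {D : Type*} [Category D] (F : D ⥤ (X → Type u)) (a : D)
    (x : X) (e : F.obj a x) : F.map (𝟙 a) x e = e :=
  congrArg (fun k => k e) (congrFun (F.map_id a) x)

lemma Pi.naturality_apply {X : Type u} {D : Type*} [Category D] {F G : D ⥤ (X → Type u)}
    (α : F ⟶ G) {a b : D} (f : a ⟶ b) (x : X) (e : F.obj a x) :
    α.app b x (F.map f x e) = G.map f x (α.app a x e) :=
  congrArg (fun k => k e) (congrFun (α.naturality f) x)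

def famRanAdj : famOb C X ⊣ famRan C X where
  unit :=
    { app := fun F =>
        { app := fun c x => ↾fun e d h => F.map h x e
          naturality := fun c c' g => by
            ext x e
            funext d h
            exact (Pi.map_comp_apply F g h x e).symm }
      naturality := fun F G α => by
        ext c x e
        funext d h
        exact (Pi.naturality_apply α h x e).symm }
  counit := { app := fun A => fun p => ↾fun φ => φ p.1 (𝟙 p.1) }
  left_triangle_components F := by
    funext p
    ext e
    exact Pi.map_id_apply F p.1 p.2 e
  right_triangle_components A := by
    ext c x φ
    funext d h
    exact congrArg (φ d) (Category.comp_id h)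

/-- It makes `famOb` a right adjoint as well, hence limit-preserving, which the cartesianness of the
tensor comonad needs. -/
def famLanAdj : famLan C X ⊣ famOb C X where
  unit := { app := fun A => fun p => ↾fun a => ⟨p.1, 𝟙 p.1, a⟩ }
  counit :=
    { app := fun F =>
        { app := fun c x => ↾fun t => F.map t.2.1 x t.2.2
          naturality := fun c c' g => by
            ext x t
            exact Pi.map_comp_apply F t.2.1 g x t.2.2 }
      naturality := fun F G α => by
        ext c x t
        exact (Pi.naturality_apply α t.2.1 x t.2.2).symm }
  left_triangle_components A := by
    ext c x t
    exact congrArg (fun k => (⟨t.1, k, t.2.2⟩ : Σ d : C, (d ⟶ c) × A (d, x)))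
      (Category.id_comp t.2.1)
  right_triangle_components F := by
    funext p
    ext e
    exact Pi.map_id_apply F p.1 p.2 e

end Families

/-! ### The comonad of the tensor -/

section Tensor

variable (C : Type u) [SmallCategory C] {X : Type u} (W : Comonad (X → Type u))

def tensorAdj : ((Functor.whiskeringRight C _ _).obj W.forget ⋙ famOb C X) ⊣
    (famRan C X ⋙ (Functor.whiskeringRight C _ _).obj W.cofree) :=
  (W.forgetCofreeAdj.whiskerRight C).comp (famRanAdj C X)

/-- The interior comonad of the tensor of an ionad by a small category. -/
def tensorComonad : Comonad (C × X → Type u) := (tensorAdj C W).toComonad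

lemma tensorComonad_preservesFiniteLimits [PreservesFiniteLimits W.toFunctor] :
    PreservesFiniteLimits (tensorComonad C W).toFunctor := by
  have h₁ := (famRanAdj C X).rightAdjoint_preservesLimits
  have h₂ := (famLanAdj C X).rightAdjoint_preservesLimits
  have h₀ := Pi.hasLimits_types X
  have h₃ : PreservesFiniteLimits ((Functor.whiskeringRight C _ _).obj W.toFunctor) :=
    ⟨fun _ _ _ => inferInstance⟩
  change PreservesFiniteLimits (famRan C X ⋙ (Functor.whiskeringRight C _ _).obj W.toFunctor ⋙
    famOb C X)
  infer_instance

/-- The comparison functor from diagrams of opens to opens of the tensor. -/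
def toTensorOpens : (C ⥤ W.Coalgebra) ⥤ (tensorComonad C W).Coalgebra :=
  Comonad.comparison (tensorAdj C W)

variable {C W}

/-- The projections of the right Kan extension. -/
def famEv (A : C × X → Type u) {c d : C} (h : c ⟶ d) :
    ((famRan C X).obj A).obj c ⟶ fun x => A (d, x) :=
  fun _ => ↾fun φ => φ d h

lemma map_famEv (A : C × X → Type u) {c d d' : C} (g : c ⟶ d) (h : d ⟶ d') :
    ((famRan C X).obj A).map g ≫ famEv A h = famEv A (g ≫ h) := rfl

def famUnit (P : C ⥤ W.Coalgebra) (c : C) :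
    (P.obj c).A ⟶ ((famRan C X).obj fun p => (P.obj p.1).A p.2).obj c :=
  fun x => ↾fun e _ h => (P.map h).f x e

lemma famUnit_famEv (P : C ⥤ W.Coalgebra) {c d : C} (h : c ⟶ d) :
    famUnit P c ≫ famEv _ h = (P.map h).f := rfl

lemma toTensorOpens_a (P : C ⥤ W.Coalgebra) (c : C) :
    (fun x => ((toTensorOpens C W).obj P).a (c, x)) = (P.obj c).a ≫ W.map (famUnit P c) := by
  rfl

namespace TensorCoalgebra

variable (Q : (tensorComonad C W).Coalgebra)

def str (c : C) : (fun x => Q.A (c, x)) ⟶ W.obj (((famRan C X).obj Q.A).obj c) :=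
  fun x => Q.a (c, x)

lemma str_counit (c : C) :
    str Q c ≫ W.ε.app _ ≫ famEv Q.A (𝟙 c) = 𝟙 _ :=
  funext fun x => congrFun Q.counit (c, x)

lemma str_coassoc {c d : C} (h : c ⟶ d) :
    str Q c ≫ W.map (famEv Q.A h ≫ str Q d) =
      str Q c ≫ W.δ.app _ ≫ W.map (W.map (((famRan C X).obj Q.A).map h)) := by
  -- The comultiplication of the composite comonad is that of `W` followed by the unit of the Kan
  -- extension. Projecting to the component at `h` then leaves an identity involving `W` alone.
  have key : str Q c ≫ (W.δ.app _ ≫ W.map (fun x => ↾fun w d h =>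
        W.map (((famRan C X).obj Q.A).map h) x w)) =
      str Q c ≫ W.map (((famRan C X).map Q.a).app c) :=
    funext fun x => congrFun Q.coassoc (c, x)
  have := congrArg (fun k => k ≫ W.map (famEv ((tensorComonad C W).obj Q.A) h)) key
  simp only [Category.assoc, ← Functor.map_comp] at this
  exact this.symm

end TensorCoalgebra

end Tensor

/-! ### Opens of the tensor as diagrams of opens -/

/-- The structure of a coalgebra for the tensor comonad, in terms of the projections `ev` of a right
Kan extension `R`. -/
structure KanCoalgebra {D : Type*} [Category D] (W : Comonad D) (C : Type*) [Category C] where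
  A : C → D
  R : C ⥤ D
  ev : ∀ {c d : C}, (c ⟶ d) → (R.obj c ⟶ A d)
  map_ev : ∀ {c d d' : C} (g : c ⟶ d) (h : d ⟶ d'), R.map g ≫ ev h = ev (g ≫ h)
  str : ∀ c, A c ⟶ W.obj (R.obj c)
  counit : ∀ c, str c ≫ W.ε.app _ ≫ ev (𝟙 c) = 𝟙 _
  coassoc : ∀ {c d : C} (h : c ⟶ d),
    str c ≫ W.map (ev h ≫ str d) = str c ≫ W.δ.app _ ≫ W.map (W.map (R.map h))

namespace KanCoalgebra

variable {D : Type*} [Category D] {W : Comonad D} {C : Type*} [Category C] (Q : KanCoalgebra W C)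

/-- Coassociativity followed by the counit of `W`. This is what makes the action in `diagram`
functorial. -/
lemma str_counit_naturality {c d : C} (h : c ⟶ d) :
    Q.str c ≫ W.ε.app _ ≫ Q.ev h ≫ Q.str d = Q.str c ≫ W.map (Q.R.map h) := by
  have := congrArg (fun k => k ≫ W.ε.app _) (Q.coassoc h)
  simpa only [Category.assoc, Comonad.counit_naturality, Comonad.left_counit_assoc] using this

lemma coassoc_id (c : C) :
    Q.str c ≫ W.map (Q.ev (𝟙 c) ≫ Q.str c) = Q.str c ≫ W.δ.app _ := by
  rw [Q.coassoc, Q.R.map_id, W.map_id, W.map_id]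
  exact congrArg (fun k => Q.str c ≫ k) (Category.comp_id _)

/-- The action of the arrows of `C`. -/
@[simps]
def diagram : C ⥤ D where
  obj := Q.A
  map h := Q.str _ ≫ W.ε.app _ ≫ Q.ev h
  map_id c := Q.counit c
  map_comp {c d d'} g h := by
    have := congrArg (fun k => k ≫ W.ε.app _ ≫ Q.ev h) (Q.str_counit_naturality g)
    simp only [Category.assoc, Comonad.counit_naturality_assoc, map_ev] at this
    simp only [Category.assoc, this]

/-- Both sides reduce to `Q.str c ≫ W.map (Q.ev h)`, the left by coassociativity at the identity and
the right by `str_counit_naturality`. -/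
lemma str_ev_naturality {c d : C} (h : c ⟶ d) :
    (Q.str c ≫ W.map (Q.ev (𝟙 c))) ≫ W.map (Q.str c ≫ W.ε.app _ ≫ Q.ev h) =
      (Q.str c ≫ W.ε.app _ ≫ Q.ev h) ≫ Q.str d ≫ W.map (Q.ev (𝟙 d)) := by
  have h₁ := congrArg (fun k => k ≫ W.map (Q.ev (𝟙 d))) (Q.str_counit_naturality h)
  have h₂ := congrArg (fun k => k ≫ W.map (W.ε.app _ ≫ Q.ev h)) (Q.coassoc_id c)
  simp only [Category.assoc, ← Functor.map_comp, map_ev, Category.comp_id] at h₁ h₂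
  simp only [Functor.map_comp, Comonad.right_counit_assoc] at h₂
  simp only [Category.assoc, h₁, Functor.map_comp, h₂]

lemma str_ev_counit (c : C) : (Q.str c ≫ W.map (Q.ev (𝟙 c))) ≫ W.ε.app (Q.A c) = 𝟙 _ := by
  simpa only [Category.assoc, Comonad.counit_naturality] using Q.counit c

lemma str_ev_coassoc (c : C) : (Q.str c ≫ W.map (Q.ev (𝟙 c))) ≫ W.δ.app (Q.A c) =
    (Q.str c ≫ W.map (Q.ev (𝟙 c))) ≫ W.map (Q.str c ≫ W.map (Q.ev (𝟙 c))) := by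
  have h := congrArg (fun k => k ≫ W.map (W.map (Q.ev (𝟙 c)))) (Q.coassoc_id c)
  simp only [Category.assoc, Functor.map_comp] at h
  simp only [Category.assoc, Comonad.delta_naturality, Functor.map_comp]
  exact h.symm

/-- The diagram of coalgebras. -/
def toDiagram : C ⥤ W.Coalgebra :=
  Comonad.liftCoalgebra Q.diagram
    { app := fun c => Q.str c ≫ W.map (Q.ev (𝟙 c))
      naturality := fun _ _ h => (Q.str_ev_naturality h).symm }
    Q.str_ev_counit Q.str_ev_coassoc

/-- The structure map is recovered from the coalgebra structure at `c` and the action of arrows, so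
passing to `toDiagram` loses nothing. -/
lemma str_ev_str_counit (c : C) :
    (Q.str c ≫ W.map (Q.ev (𝟙 c))) ≫ W.map (Q.str c ≫ W.ε.app _) = Q.str c := by
  have h := congrArg (fun k => k ≫ W.map (W.ε.app _)) (Q.coassoc_id c)
  simpa only [Category.assoc, Functor.map_comp, Comonad.right_counit, Category.comp_id] using h

end KanCoalgebra

section TensorOpens

variable {C : Type u} [SmallCategory C] {X : Type u} {W : Comonad (X → Type u)}

/-- The underlying diagram data of an open of the tensor. -/
def toKanCoalgebra (Q : (tensorComonad C W).Coalgebra) : KanCoalgebra W C where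
  A c := fun x => Q.A (c, x)
  R := (famRan C X).obj Q.A
  ev := famEv Q.A
  map_ev := map_famEv Q.A
  str := TensorCoalgebra.str Q
  counit := TensorCoalgebra.str_counit Q
  coassoc := TensorCoalgebra.str_coassoc Q

lemma tensorCoalgebra_ext {A : C × X → Type u} {a a' : A ⟶ (tensorComonad C W).obj A}
    {h₁ h₂ h₁' h₂'} (h : a = a') :
    (⟨A, a, h₁, h₂⟩ : (tensorComonad C W).Coalgebra) = ⟨A, a', h₁', h₂'⟩ := by
  subst h
  rfl

lemma toTensorOpens_toDiagram (Q : (tensorComonad C W).Coalgebra) :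
    (toTensorOpens C W).obj (toKanCoalgebra Q).toDiagram = Q := by
  refine tensorCoalgebra_ext (a' := Q.a) (funext fun p => ?_)
  obtain ⟨c, x⟩ := p
  exact (congrFun (toTensorOpens_a (toKanCoalgebra Q).toDiagram c) x).trans
    (congrFun ((toKanCoalgebra Q).str_ev_str_counit c) x)

lemma famUnit_famEv_id (P : C ⥤ W.Coalgebra) (c : C) :
    famUnit P c ≫ famEv _ (𝟙 c) = 𝟙 _ :=
  (famUnit_famEv P (𝟙 c)).trans (by rw [P.map_id]; rfl)

lemma coalgebra_str_counit {D : Type*} [Category D] {W : Comonad D} (P : W.Coalgebra) {R A : D}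
    (u : P.A ⟶ R) (e : R ⟶ A) : (P.a ≫ W.map u) ≫ W.ε.app _ ≫ e = u ≫ e := by
  simp only [Category.assoc, Comonad.counit_naturality_assoc, Comonad.Coalgebra.counit_assoc]

lemma coalgebra_str_ev {D : Type*} [Category D] {W : Comonad D} (P : W.Coalgebra) {R : D}
    (u : P.A ⟶ R) (e : R ⟶ P.A) (h : u ≫ e = 𝟙 _) : (P.a ≫ W.map u) ≫ W.map e = P.a := by
  rw [Category.assoc, ← Functor.map_comp, h, CategoryTheory.Functor.map_id]
  exact Category.comp_id _

/-- Reading off the component at `h` of the Kan unit `famUnit` returns `P.map h`. This recovers the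
arrows, and with `h` an identity it recovers the coalgebra structures. -/
lemma toDiagram_toTensorOpens (P : C ⥤ W.Coalgebra) :
    (toKanCoalgebra ((toTensorOpens C W).obj P)).toDiagram = P := by
  have hstr : ∀ c, TensorCoalgebra.str ((toTensorOpens C W).obj P) c =
      (P.obj c).a ≫ W.map (famUnit P c) := toTensorOpens_a P
  obtain ⟨a, h₁, h₂, e⟩ := Comonad.exists_eq_liftCoalgebra (S := P) rfl
  refine Eq.trans (Comonad.liftCoalgebra_congr ?_ fun c => heq_of_eq (a' := a.app c) ?_)
    e.symm
  · refine CategoryTheory.Functor.ext (fun _ => rfl) fun c d h => ?_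
    refine Eq.trans ?_ ((Category.id_comp _).trans (Category.comp_id _)).symm
    exact (congrArg (fun k => k ≫ W.ε.app _ ≫ famEv _ h) (hstr c)).trans
      ((coalgebra_str_counit (P.obj c) _ _).trans (famUnit_famEv P h))
  · have ha : (P.obj c).a = a.app c := eq_of_heq (Comonad.Coalgebra.a_heq (Functor.congr_obj e c))
    refine Eq.trans ?_ ha
    exact (congrArg (fun k => k ≫ W.map (famEv _ (𝟙 c))) (hstr c)).trans
      (coalgebra_str_ev (P.obj c) _ _ (famUnit_famEv_id P c))

lemma coalgebraHom_of_section {D : Type*} [Category D] {W : Comonad D} {P Q : W.Coalgebra}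
    {R S : D} {u : P.A ⟶ R} {v : Q.A ⟶ S} {r : R ⟶ S} {f : P.A ⟶ Q.A} {e : S ⟶ Q.A}
    (h : (P.a ≫ W.map u) ≫ W.map r = f ≫ Q.a ≫ W.map v) (hu : u ≫ r ≫ e = f) (hv : v ≫ e = 𝟙 _) :
    P.a ≫ W.map f = f ≫ Q.a := by
  have := congrArg (fun k => k ≫ W.map e) h
  simpa only [Category.assoc, ← Functor.map_comp, hu, hv, CategoryTheory.Functor.map_id,
    Category.comp_id] using this

lemma coalgebraHom_naturality {D : Type*} [Category D] {W : Comonad D} {P Q : W.Coalgebra}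
    {R S : D} {u : P.A ⟶ R} {v : Q.A ⟶ S} {r : R ⟶ S} {f : P.A ⟶ Q.A}
    (h : (P.a ≫ W.map u) ≫ W.map r = f ≫ Q.a ≫ W.map v) : u ≫ r = f ≫ v := by
  have := congrArg (fun k => k ≫ W.ε.app _) h
  simpa only [Category.assoc, Comonad.counit_naturality, Comonad.counit_naturality_assoc,
    Comonad.Coalgebra.counit_assoc] using this

/-- For fullness, projecting a map of tensor coalgebras at identities gives coalgebra maps, and
applying the counit of `W` gives their naturality in `C`. -/
lemma toTensorOpens_isCatIso : IsCatIso (toTensorOpens C W) := by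
  have : (toTensorOpens C W).Faithful := ⟨fun {P Q} f g hfg => by
    refine NatTrans.ext (funext fun c => Comonad.Coalgebra.Hom.ext (funext fun x => ?_))
    exact congrFun (congrArg Comonad.Coalgebra.Hom.f hfg) (c, x)⟩
  have : (toTensorOpens C W).Full := ⟨fun {P Q} φ => by
    let φ' : ∀ c, (P.obj c).A ⟶ (Q.obj c).A := fun c x => φ.f (c, x)
    have key : ∀ c, ((P.obj c).a ≫ W.map (famUnit P c)) ≫ W.map (((famRan C X).map φ.f).app c) =
        φ' c ≫ (Q.obj c).a ≫ W.map (famUnit Q c) := fun c =>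
      funext fun x => congrFun φ.h (c, x)
    refine ⟨{ app := fun c => { f := φ' c, h := ?_ }, naturality := fun c d h => ?_ }, rfl⟩
    · refine coalgebraHom_of_section (key c) (e := famEv _ (𝟙 c)) ?_ (famUnit_famEv_id Q c)
      exact (congrArg (fun k => k ≫ φ' c) (famUnit_famEv_id P c)).trans (Category.id_comp _)
    · refine Comonad.Coalgebra.Hom.ext ?_
      exact congrArg (fun k => k ≫ famEv _ h) (coalgebraHom_naturality (key c))⟩
  exact IsCatIso.of_bijective _
    ⟨fun P P' h => by rw [← toDiagram_toTensorOpens P, h, toDiagram_toTensorOpens],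
      fun Q => ⟨_, toTensorOpens_toDiagram Q⟩⟩

end TensorOpens

/-! ### The tensor is generated by the tensor basis -/

/-- The elements of `M` at `x` sit coreflectively among those of the tensor basis at `(c', x)`, as
the elements with first component `𝟙 c'`. Cofilteredness passes along a left adjoint. -/
lemma tensorBasis_isFlat (C : Type u) [SmallCategory C] {X B : Type u} [SmallCategory B]
    {M : B ⥤ (X → Type u)} (hM : IsFlat M) : IsFlat (tensorBasis C M) := by
  rintro ⟨c', x⟩
  have := hM x
  let L : (M ⋙ Pi.eval (fun _ : X => Type u) x).Elements ⥤
      (tensorBasis C M ⋙ Pi.eval (fun _ : C × X => Type u) (c', x)).Elements :=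
    { obj := fun t => ⟨(Opposite.op c', t.1), (𝟙 c', t.2)⟩
      map := fun f => ⟨(𝟙 _, f.1), Prod.ext (Category.id_comp _) f.2⟩
      map_id := fun _ => rfl
      map_comp := fun f g => Subtype.ext (Prod.ext (Category.id_comp _).symm rfl) }
  let R : (tensorBasis C M ⋙ Pi.eval (fun _ : C × X => Type u) (c', x)).Elements ⥤
      (M ⋙ Pi.eval (fun _ : X => Type u) x).Elements :=
    { obj := fun t => ⟨t.1.2, t.2.2⟩
      map := fun f => ⟨f.1.2, congrArg Prod.snd f.2⟩ }
  have hL : ∀ {s t} (f : L.obj s ⟶ t), f.1.1.unop = t.2.1 := fun {s t} f =>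
    (Category.comp_id _).symm.trans (congrArg Prod.fst f.2)
  let adj : L ⊣ R := Adjunction.mkOfHomEquiv
    { homEquiv := fun s t =>
        { toFun := fun f => ⟨f.1.2, congrArg Prod.snd f.2⟩
          invFun := fun f => ⟨(t.2.1.op, f.1), Prod.ext (Category.comp_id _) f.2⟩
          left_inv := fun f => Subtype.ext (Prod.ext (Quiver.Hom.unop_inj (hL f).symm) rfl)
          right_inv := fun f => rfl }
      homEquiv_naturality_left_symm := fun f g =>
        Subtype.ext (Prod.ext (Category.id_comp _).symm rfl)
      homEquiv_naturality_right := fun f g => rfl }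
  exact IsCofiltered.of_left_adjoint adj

/-! ### Currying presheaves on `Cᵒᵖ × B` -/

section Curry

variable (C B : Type u) [SmallCategory C] [SmallCategory B]

@[simps]
def curryPresheaf : ((Cᵒᵖ × B)ᵒᵖ ⥤ Type u) ⥤ (C ⥤ (Bᵒᵖ ⥤ Type u)) where
  obj P :=
    { obj := fun c =>
        { obj := fun b => P.obj (Opposite.op (Opposite.op c, b.unop))
          map := fun {b b'} f => P.map (Quiver.Hom.op (show (Opposite.op c, b'.unop) ⟶
            (Opposite.op c, b.unop) from (𝟙 _, f.unop)))
          map_id := fun b => P.map_id _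
          map_comp := fun f g => by
            rw [← P.map_comp]
            exact congrArg (fun k => P.map (Quiver.Hom.op k))
              (Prod.ext (Category.comp_id _).symm rfl) }
      map := fun {c d} g =>
        { app := fun b => P.map (Quiver.Hom.op (show (Opposite.op d, b.unop) ⟶
            (Opposite.op c, b.unop) from (g.op, 𝟙 _)))
          naturality := fun b b' f => by
            rw [← P.map_comp, ← P.map_comp]
            exact congrArg (fun k => P.map (Quiver.Hom.op k))
              (Prod.ext ((Category.comp_id _).trans (Category.id_comp _).symm)
                ((Category.id_comp _).trans (Category.comp_id _).symm)) }
      map_id := fun c => NatTrans.ext (funext fun b => P.map_id _)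
      map_comp := fun g h => NatTrans.ext (funext fun b => by
        dsimp
        rw [← P.map_comp]
        exact congrArg (fun k => P.map (Quiver.Hom.op k))
          (Prod.ext rfl (Category.comp_id _).symm)) }
  map α :=
    { app := fun c => { app := fun b => α.app _, naturality := fun _ _ _ => α.naturality _ }
      naturality := fun _ _ _ => NatTrans.ext (funext fun b => α.naturality _) }

@[simps]
def uncurryPresheaf : (C ⥤ (Bᵒᵖ ⥤ Type u)) ⥤ ((Cᵒᵖ × B)ᵒᵖ ⥤ Type u) where
  obj Q :=
    { obj := fun p => (Q.obj p.unop.1.unop).obj (Opposite.op p.unop.2)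
      map := fun {p q} f => (Q.map f.unop.1.unop).app _ ≫ (Q.obj _).map f.unop.2.op
      map_id := fun p => by simp
      map_comp := fun f g => by simp }
  map α :=
    { app := fun p => (α.app _).app _
      naturality := fun p q f => by
        dsimp
        rw [Category.assoc, NatTrans.naturality, ← Category.assoc, ← NatTrans.comp_app,
          NatTrans.naturality]
        simp }

def curryPresheafEquiv : ((Cᵒᵖ × B)ᵒᵖ ⥤ Type u) ≌ (C ⥤ (Bᵒᵖ ⥤ Type u)) :=
  CategoryTheory.Equivalence.mk (curryPresheaf C B) (uncurryPresheaf C B)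
    (NatIso.ofComponents (fun P => NatIso.ofComponents (fun p => Iso.refl _) (fun {p q} f => by
      refine (Category.comp_id _).trans (Eq.trans ?_ (Category.id_comp _).symm)
      refine Eq.trans ?_ (P.map_comp _ _)
      exact congrArg (fun k => P.map (Quiver.Hom.op k))
        (Prod.ext (Category.id_comp _).symm (Category.comp_id _).symm)))
      (fun α => by ext p e; rfl))
    (NatIso.ofComponents (fun Q => NatIso.ofComponents (fun c =>
      NatIso.ofComponents (fun b => Iso.refl _) (fun {b b'} f => by
        refine (Category.comp_id _).trans (Eq.trans ?_ (Category.id_comp _).symm)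
        exact (congrArg (fun k => k.app b ≫ (Q.obj c).map f) (Q.map_id c)).trans
          (Category.id_comp _))) (fun {c d} g => by
        refine NatTrans.ext (funext fun b => ?_)
        refine (Category.comp_id _).trans (Eq.trans ?_ (Category.id_comp _).symm)
        exact (congrArg (fun k => (Q.map g).app b ≫ k) ((Q.obj d).map_id b)).trans
          (Category.comp_id _))) (fun α => by ext c b e; rfl))

end Curry

lemma CategoryTheory.Adjunction.toComonad_equivalence_comp {A A' D : Type*} [Category A]
    [Category A'] [Category D] {L : A ⥤ D} {R : D ⥤ A} (adj : L ⊣ R) (e : A' ≌ A) :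
    Nonempty ((e.toAdjunction.comp adj).toComonad ≅ adj.toComonad) := by
  refine ⟨ComonadIso.mk (Functor.isoWhiskerLeft R (Functor.isoWhiskerRight e.counitIso L))
    (fun X => ?_) (fun X => ?_)⟩
  · simp only [CategoryTheory.Adjunction.comp, Adjunction.toComonad]
    simp
  -- The comultiplication law before `L` is applied: it follows from naturality and a triangle
  -- identity of the equivalence.
  · have key : e.counit.app (R.obj X) ≫ adj.unit.app (R.obj X) =
        e.functor.map (e.unit.app (e.inverse.obj (R.obj X)) ≫
          e.inverse.map (adj.unit.app (e.functor.obj (e.inverse.obj (R.obj X))))) ≫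
        e.counit.app (R.obj (L.obj (e.functor.obj (e.inverse.obj (R.obj X))))) ≫
          R.map (L.map (e.counit.app (R.obj X))) := by
      simp
    have := congrArg L.map key
    simp only [Functor.map_comp, Category.assoc] at this
    simp only [CategoryTheory.Adjunction.comp, Adjunction.toComonad]
    simpa using! this

lemma CategoryTheory.Adjunction.comonadIso_app_δ_map {A D : Type*} [Category A] [Category D]
    {L : A ⥤ D} {R : D ⥤ A} (adj : L ⊣ R) {W : Comonad D} (κ : adj.toComonad ≅ W) {Y Y₁ Y₂ : D}
    {u₁ : L.obj (R.obj Y) ⟶ Y₁} {u₂ : W.obj Y ⟶ Y₂} {r : Y₁ ⟶ Y₂} (h : u₁ ≫ r = κ.hom.app Y ≫ u₂) :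
    κ.hom.app Y ≫ W.δ.app Y ≫ W.map u₂ =
      L.map (adj.unit.app (R.obj Y) ≫ R.map u₁) ≫ κ.hom.app Y₁ ≫ W.map r := by
  -- The components of `κ` are abstracted with source `L.obj (R.obj Y)`, which agrees only
  -- definitionally with the object given by `adj.toComonad`, so that rewriting applies.
  have aux : ∀ k : ∀ Y, L.obj (R.obj Y) ⟶ W.obj Y,
      (k Y ≫ W.δ.app Y = L.map (adj.unit.app (R.obj Y)) ≫ k (L.obj (R.obj Y)) ≫ W.map (k Y)) →
      (L.map (R.map u₁) ≫ k Y₁ = k (L.obj (R.obj Y)) ≫ W.map u₁) → (u₁ ≫ r = k Y ≫ u₂) →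
      k Y ≫ W.δ.app Y ≫ W.map u₂ =
        L.map (adj.unit.app (R.obj Y) ≫ R.map u₁) ≫ k Y₁ ≫ W.map r := fun k h₁ h₂ h₃ => by
    rw [reassoc_of% h₁, Functor.map_comp, Category.assoc, reassoc_of% h₂, ← Functor.map_comp,
      ← Functor.map_comp, h₃]
  exact aux (fun Y => κ.hom.app Y) (κ.hom.app_δ Y) (κ.hom.naturality u₁) h

section Generates

variable (C : Type u) [SmallCategory C] {X B : Type u} [SmallCategory B]
  {L : (Bᵒᵖ ⥤ Type u) ⥤ (X → Type u)} {R : (X → Type u) ⥤ (Bᵒᵖ ⥤ Type u)} (adj : L ⊣ R)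
  {W : Comonad (X → Type u)}

lemma toComonad_whiskerRight_comp_famRanAdj (κ : adj.toComonad ≅ W) :
    Nonempty (((adj.whiskerRight C).comp (famRanAdj C X)).toComonad ≅ tensorComonad C W) := by
  have hε : ∀ A, κ.hom.app A ≫ W.ε.app A = adj.counit.app A := fun A => κ.hom.app_ε A
  let κ' : R ⋙ L ≅ W.toFunctor := (comonadToFunctor _).mapIso κ
  refine ⟨ComonadIso.mk (Functor.isoWhiskerLeft (famRan C X) (Functor.isoWhiskerRight
    ((Functor.whiskeringRight C _ _).mapIso κ') (famOb C X))) (fun A => ?_) (fun A => ?_)⟩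
  · funext p
    exact congrFun (congrArg (fun k => k ≫ famEv A (𝟙 p.1)) (hε _)) p.2
  · funext p
    let u : ∀ (F : C ⥤ (X → Type u)) (c : C), F.obj c ⟶ ((famRan C X).obj ((famOb C X).obj F)).obj c :=
      fun F c => ((famRanAdj C X).unit.app F).app c
    have key := adj.comonadIso_app_δ_map κ (u₁ := u ((famRan C X).obj A ⋙ R ⋙ L) p.1)
      (u₂ := u ((famRan C X).obj A ⋙ W.toFunctor) p.1)
      (r := ((famRan C X).map ((famOb C X).map
          (Functor.whiskerLeft ((famRan C X).obj A) κ'.hom))).app p.1)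
      (NatTrans.congr_app ((famRanAdj C X).unit.naturality
          (Functor.whiskerLeft ((famRan C X).obj A) κ'.hom)) p.1).symm
    exact congrFun key p.2

/-- `hF` says that `F` is the copower of `P` by `S`, and `L`, being a left adjoint, preserves
copowers. The inverse `r` is the transpose of the map which the universal property of `F` provides.
-/
lemma copower_bijective (adj : L ⊣ R) {P F : Bᵒᵖ ⥤ Type u} {S : Type u} (i : S → (P ⟶ F))
    (hF : ∀ b, Function.Bijective fun p : S × P.obj b => (i p.1).app b p.2) (x : X) :
    Function.Bijective fun p : S × L.obj P x => L.map (i p.1) x p.2 := by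
  have hi : ∀ {G : Bᵒᵖ ⥤ Type u} (f : S → (P ⟶ G)), ∃ g : F ⟶ G, ∀ s, i s ≫ g = f s := by
    intro G f
    let e := fun b => Equiv.ofBijective _ (hF b)
    have he : ∀ b s a, (e b).symm ((i s).app b a) = (s, a) := fun b s a =>
      (e b).symm_apply_apply (s, a)
    refine ⟨{ app := fun b => ↾fun t => (f ((e b).symm t).1).app b ((e b).symm t).2,
              naturality := fun b b' k => ?_ }, fun s => ?_⟩
    · ext t
      obtain ⟨⟨s, a⟩, rfl⟩ := (e b).surjective t
      have h : F.map k (e b (s, a)) = (i s).app b' (P.map k a) :=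
        (NatTrans.naturality_apply (i s) k a).symm
      change (f ((e b').symm (F.map k (e b (s, a)))).1).app b' ((e b').symm (F.map k (e b (s, a)))).2 =
        G.map k ((f ((e b).symm (e b (s, a))).1).app b ((e b).symm (e b (s, a))).2)
      rw [h, he, (e b).symm_apply_apply]
      exact NatTrans.naturality_apply (f s) k a
    · ext b a
      change (f ((e b).symm ((i s).app b a)).1).app b ((e b).symm ((i s).app b a)).2 = _
      rw [he]
      rfl
  have hext : ∀ {G : Bᵒᵖ ⥤ Type u} {g g' : F ⟶ G}, (∀ s, i s ≫ g = i s ≫ g') → g = g' := by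
    intro G g g' h
    ext b t
    obtain ⟨⟨s, a⟩, rfl⟩ := (hF b).2 t
    exact congrArg (fun k : P ⟶ G => k.app b a) (h s)
  let Z : X → Type u := fun x => S × L.obj P x
  obtain ⟨g, hg⟩ := hi fun s => adj.homEquiv P Z fun x => ↾fun t => (s, t)
  let r : L.obj F ⟶ Z := (adj.homEquiv F Z).symm g
  have hr : ∀ s, L.map (i s) ≫ r = fun x => ↾fun t => (s, t) := fun s => by
    rw [← adj.homEquiv_naturality_left_symm, hg, Equiv.symm_apply_apply]
  let m : Z ⟶ L.obj F := fun x => ↾fun p => L.map (i p.1) x p.2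
  have hm : r ≫ m = 𝟙 _ := by
    refine (adj.homEquiv _ _).injective (hext fun s => ?_)
    rw [← adj.homEquiv_naturality_left, ← adj.homEquiv_naturality_left, ← Category.assoc, hr,
      Category.comp_id]
    rfl
  refine Function.bijective_iff_has_inverse.mpr ⟨fun t => r x t, fun p => ?_, fun t => ?_⟩
  · exact congrArg (fun k => k p.2) (congrFun (hr p.1) x)
  · exact congrArg (fun k => k t) (congrFun hm x)

end Generates

/-- Currying the representable at `(c, b)` gives at `c'` the copower of `yoneda.obj b` by `C(c,
c')`. The functor `L` preserves it and sends `yoneda.obj b` to `M.obj b`. -/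
theorem generates_tensorBasis (C : Type u) [SmallCategory C] {X B : Type u} [SmallCategory B]
    {M : B ⥤ (X → Type u)} {W : Comonad (X → Type u)} (hM : Generates M W) :
    Generates (tensorBasis C M) (tensorComonad C W) := by
  obtain ⟨L, R, adj, ⟨m⟩, ⟨κ⟩⟩ := hM
  refine ⟨_, _, (curryPresheafEquiv C B).toAdjunction.comp
    ((adj.whiskerRight C).comp (famRanAdj C X)), ⟨?_⟩, ?_⟩
  · let i : ∀ (p : Cᵒᵖ × B) (c : C), (p.1.unop ⟶ c) →
        (yoneda.obj p.2 ⟶ ((curryPresheaf C B).obj (yoneda.obj p)).obj c) := fun p c s =>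
      { app := fun b => ↾fun k => (s.op, k)
        naturality := fun b b' f => by
          ext k
          exact Prod.ext (Category.id_comp _).symm rfl }
    have hi : ∀ (p : Cᵒᵖ × B) (c : C) (b : Bᵒᵖ), Function.Bijective
        fun q : (p.1.unop ⟶ c) × (yoneda.obj p.2).obj b => (i p c q.1).app b q.2 := fun p c b =>
      ⟨fun q q' h => Prod.ext (Quiver.Hom.op_inj (Prod.ext_iff.mp h).1) (Prod.ext_iff.mp h).2,
        fun q => ⟨(q.1.unop, q.2), rfl⟩⟩
    let e : ∀ (p : Cᵒᵖ × B) (c : C) (x : X),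
        ((p.1.unop ⟶ c) × M.obj p.2 x) ≃
          L.obj (((curryPresheaf C B).obj (yoneda.obj p)).obj c) x := fun p c x =>
      (Equiv.prodCongr (Equiv.refl _) (Iso.toEquiv
        ⟨m.inv.app p.2 x, m.hom.app p.2 x, congrFun (m.inv_hom_id_app p.2) x,
          congrFun (m.hom_inv_id_app p.2) x⟩)).trans
        (Equiv.ofBijective _ (copower_bijective adj (i p c) (hi p c) x))
    refine (NatIso.ofComponents (fun p => Pi.isoMk fun q => (e p q.1 q.2).toIso) ?_).symm
    intro p p' f
    funext q
    ext t
    obtain ⟨c, x⟩ := q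
    obtain ⟨s, t⟩ := t
    change L.map (i p' c (f.1.unop ≫ s)) x (m.inv.app p'.2 x (M.map f.2 x t)) =
      L.map (((curryPresheaf C B).map (yoneda.map f)).app c) x
        (L.map (i p c s) x (m.inv.app p.2 x t))
    have h₁ : m.inv.app p'.2 x (M.map f.2 x t) =
      L.map (yoneda.map f.2) x (m.inv.app p.2 x t) := Pi.naturality_apply m.inv f.2 x t
    rw [h₁, ← Pi.map_comp_apply, ← Pi.map_comp_apply]
    rfl
  · obtain ⟨k⟩ := toComonad_whiskerRight_comp_famRanAdj C adj κ
    obtain ⟨k'⟩ := ((adj.whiskerRight C).comp (famRanAdj C X)).toComonad_equivalence_comp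
      (curryPresheafEquiv C B)
    exact ⟨k' ≪≫ k⟩

/-! ### The tensor ionad -/

/-- The tensor of an ionad by a small category. -/
def tensorIonad (C : Type u) [SmallCategory C] (X : Ionad.{u}) : Ionad.{u} where
  pts := C × X.pts
  int := tensorComonad C X.int
  cartesian := by
    have := X.cartesian
    exact tensorComonad_preservesFiniteLimits C X.int

lemma tensorIonad_isGeneratedBy (C : Type u) [SmallCategory C] (X : Ionad.{u}) {B : Type u}
    [SmallCategory B] {M : B ⥤ (X.pts → Type u)} (hM : X.IsGeneratedBy M) :
    (tensorIonad C X).IsGeneratedBy (tensorBasis C M) :=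
  ⟨tensorBasis_isFlat C hM.1, generates_tensorBasis C hM.2⟩

lemma tensorIonad_isBounded (C : Type u) [SmallCategory C] (X : BIon.{u}) :
    (tensorIonad C X.ion).IsBounded := by
  obtain ⟨B, _, M, hM⟩ := X.bounded
  exact ⟨_, _, _, tensorIonad_isGeneratedBy C X.ion hM⟩

section

variable (C : Cat.{u, u}) (X : BIon.{u})

def tensorBIon : BIon.{u} := ⟨tensorIonad C X.ion, tensorIonad_isBounded C X⟩

/-- Diagrams of opens of `X` are opens of the tensor. -/
abbrev diagramToOpens : (C ⥤ X.ion.Opens) ⥤ (tensorBIon C X).ion.Opens :=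
  toTensorOpens C X.ion.int

noncomputable def opensToDiagram : (tensorBIon C X).ion.Opens ⥤ (C ⥤ X.ion.Opens) :=
  (toTensorOpens_isCatIso (C := C) (W := X.ion.int)).choose

lemma diagramToOpens_opensToDiagram : diagramToOpens C X ⋙ opensToDiagram C X = 𝟭 _ :=
  (toTensorOpens_isCatIso (C := C) (W := X.ion.int)).choose_spec.1

lemma opensToDiagram_diagramToOpens : opensToDiagram C X ⋙ diagramToOpens C X = 𝟭 _ :=
  (toTensorOpens_isCatIso (C := C) (W := X.ion.int)).choose_spec.2

/-- The unit of the tensor. -/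
noncomputable def tensorUnit : C ⥤ (X ⟶ tensorBIon C X) where
  obj c :=
    { toFun := fun x => (c, x)
      star := opensToDiagram C X ⋙ (evaluation _ _).obj c
      comm := by
        -- The chosen inverse is opaque, but `diagramToOpens` keeps underlying families on the nose,
        -- so inserting the round trip makes the square definitional.
        have : (opensToDiagram C X ⋙ diagramToOpens C X) ⋙ (tensorBIon C X).ion.forgetOpens ⋙
          pullFam (fun x => (c, x)) = (tensorBIon C X).ion.forgetOpens ⋙
          pullFam (fun x => (c, x)) := by rw [opensToDiagram_diagramToOpens]; rfl
        exact this : Ionad.Map X.ion (tensorBIon C X).ion }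
  map g := (⟨Functor.whiskerLeft (opensToDiagram C X) ((evaluation _ _).map g)⟩ :
    Ionad.Specialisation _ _)
  map_id c := Ionad.hom₂_ext (NatTrans.ext (funext fun P => ((opensToDiagram C X).obj P).map_id c))
  map_comp g h := Ionad.hom₂_ext
    (NatTrans.ext (funext fun P => ((opensToDiagram C X).obj P).map_comp g h))

lemma isTensor_tensorUnit : IsTensor (tensorUnit C X) :=
  IsTensor.of_opens _ ⟨fun _ _ h => h, fun p => ⟨p, rfl⟩⟩
    ⟨diagramToOpens C X, opensToDiagram_diagramToOpens C X, diagramToOpens_opensToDiagram C X⟩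

end

/-! ### Elements of cartesian comonads on families of sets -/

section Elements

variable {Z : Type u}

/-- The family with a single element, over `z`. -/
def pointFam (z : Z) : Z → Type u := fun z' => ULift (PLift (z' = z))

def pointFamHom {z : Z} {A : Z → Type u} (e : A z) : pointFam z ⟶ A :=
  fun _ => ↾fun h => h.down.down ▸ e

lemma pointFam_hom_ext {z : Z} {A : Z → Type u} {f g : pointFam z ⟶ A}
    (h : f z ⟨⟨rfl⟩⟩ = g z ⟨⟨rfl⟩⟩) : f = g := by
  funext z'
  ext ⟨⟨r⟩⟩
  subst r
  exact h

lemma injective_of_mono {A B : Z → Type u} (f : A ⟶ B) [Mono f] (z : Z) :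
    Function.Injective fun e : A z => f z e := fun e e' h => by
  have : pointFamHom e = pointFamHom e' := (cancel_mono f).mp (pointFam_hom_ext h)
  exact congrArg (fun k : pointFam z ⟶ A => k z ⟨⟨rfl⟩⟩) this

lemma mono_of_injective {A B : Z → Type u} (f : A ⟶ B)
    (h : ∀ z, Function.Injective fun e : A z => f z e) : Mono f :=
  ⟨fun g g' hg => by
    funext z
    ext e
    exact h z (congrArg (fun k => k e) (congrFun hg z))⟩

def famFst (A B : Z → Type u) : (fun z => A z × B z) ⟶ A := fun _ => ↾fun p => p.1

def famSnd (A B : Z → Type u) : (fun z => A z × B z) ⟶ B := fun _ => ↾fun p => p.2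

def famProdIsLimit (A B : Z → Type u) : IsLimit (BinaryFan.mk (famFst A B) (famSnd A B)) :=
  BinaryFan.IsLimit.mk _ (fun f g z => ↾fun t => (f z t, g z t)) (fun _ _ => rfl) (fun _ _ => rfl)
    (fun f g m h₁ h₂ => by
      subst h₁ h₂
      rfl)

variable (W : (Z → Type u) ⥤ (Z → Type u)) [PreservesFiniteLimits W]

/-- Elements over `z` are maps out of `pointFam z`, so preservation of binary products can be read
elementwise. -/
lemma exists_pair {A B : Z → Type u} {z : Z} (a : W.obj A z) (b : W.obj B z) :
    ∃ w : W.obj (fun z => A z × B z) z,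
      W.map (famFst A B) z w = a ∧ W.map (famSnd A B) z w = b := by
  have hl := mapIsLimitOfPreservesOfIsLimit W _ _ (famProdIsLimit A B)
  obtain ⟨l, h₁, h₂⟩ := BinaryFan.IsLimit.lift' hl (pointFamHom a) (pointFamHom b)
  exact ⟨l z ⟨⟨rfl⟩⟩, congrArg (fun k : pointFam z ⟶ W.obj A => k z ⟨⟨rfl⟩⟩) h₁,
    congrArg (fun k : pointFam z ⟶ W.obj B => k z ⟨⟨rfl⟩⟩) h₂⟩

/-- The pairing of `f` and `g` is a monomorphism into a product, and `W` preserves both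
monomorphisms and products. -/
lemma jointly_injective_map {A B D : Z → Type u} {f : A ⟶ B} {g : A ⟶ D}
    (h : ∀ z (e e' : A z), f z e = f z e' → g z e = g z e' → e = e') (z : Z) (w w' : W.obj A z)
    (hf : W.map f z w = W.map f z w') (hg : W.map g z w = W.map g z w') : w = w' := by
  let k : A ⟶ fun z => B z × D z := fun z => ↾fun e => (f z e, g z e)
  have : Mono k := mono_of_injective k fun z e e' he =>
    h z e e' (Prod.ext_iff.mp he).1 (Prod.ext_iff.mp he).2
  refine injective_of_mono (W.map k) z ?_
  have hl := mapIsLimitOfPreservesOfIsLimit W _ _ (famProdIsLimit B D)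
  have : pointFamHom (W.map k z w) = pointFamHom (W.map k z w') := by
    refine BinaryFan.IsLimit.hom_ext hl (pointFam_hom_ext ?_) (pointFam_hom_ext ?_)
    · exact ((Pi.map_comp_apply W k (famFst B D) z w).symm.trans hf).trans
        (Pi.map_comp_apply W k (famFst B D) z w')
    · exact ((Pi.map_comp_apply W k (famSnd B D) z w).symm.trans hg).trans
        (Pi.map_comp_apply W k (famSnd B D) z w')
  exact congrArg (fun k : pointFam z ⟶ W.obj (fun z => B z × D z) => k z ⟨⟨rfl⟩⟩) this

def famUnitIsTerminal : IsTerminal (fun _ : Z => PUnit.{u + 1}) :=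
  IsTerminal.ofUniqueHom (fun _ _ => ↾fun _ => PUnit.unit) fun _ _ => rfl

noncomputable def mapUnitIsTerminal : IsTerminal (W.obj fun _ : Z => PUnit.{u + 1}) :=
  IsTerminal.isTerminalObj W _ famUnitIsTerminal

noncomputable def mapUnitElement (z : Z) : W.obj (fun _ : Z => PUnit.{u + 1}) z :=
  (mapUnitIsTerminal W).from (fun _ => PUnit.{u + 1}) z PUnit.unit

lemma eq_of_isTerminal {A : Z → Type u} (h : IsTerminal A) (z : Z) (e e' : A z) : e = e' :=
  congrArg (fun k : pointFam z ⟶ A => k z ⟨⟨rfl⟩⟩) (h.hom_ext (pointFamHom e) (pointFamHom e'))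

end Elements

/-! ### Copowers and constant coalgebras -/

section Coalgebras

variable {Z : Type u} {W : Comonad (Z → Type u)}

namespace CategoryTheory.Comonad

lemma counit_map_apply {A B : Z → Type u} (f : A ⟶ B) (z : Z) (w : W.obj A z) :
    W.ε.app B z (W.map f z w) = f z (W.ε.app A z w) :=
  Pi.naturality_apply W.ε f z w

lemma delta_map_apply {A B : Z → Type u} (f : A ⟶ B) (z : Z) (w : W.obj A z) :
    W.δ.app B z (W.map f z w) = W.map (W.map f) z (W.δ.app A z w) :=
  Pi.naturality_apply W.δ f z w

lemma map_map_apply {A B D : Z → Type u} (f : A ⟶ B) (g : B ⟶ D) (z : Z) (w : W.obj A z) :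
    W.map g z (W.map f z w) = W.map (f ≫ g) z w :=
  (Pi.map_comp_apply W.toFunctor f g z w).symm

lemma Coalgebra.counit_apply (P : W.Coalgebra) (z : Z) (e : P.A z) :
    W.ε.app P.A z (P.a z e) = e :=
  congrArg (fun k => k e) (congrFun P.counit z)

lemma Coalgebra.coassoc_apply (P : W.Coalgebra) (z : Z) (e : P.A z) :
    W.δ.app P.A z (P.a z e) = W.map P.a z (P.a z e) :=
  congrArg (fun k => k e) (congrFun P.coassoc z)

lemma Coalgebra.Hom.apply {P Q : W.Coalgebra} (f : P ⟶ Q) (z : Z) (e : P.A z) :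
    W.map f.f z (P.a z e) = Q.a z (f.f z e) :=
  congrArg (fun k => k e) (congrFun f.h z)

def copowerStr (P : W.Coalgebra) (S : Type u) :
    (fun z => S × P.A z) ⟶ W.obj fun z => S × P.A z :=
  fun z => ↾fun t => W.map (fun _ => ↾fun e => (t.1, e)) z (P.a z t.2)

/-- The coproduct of copies of a coalgebra, indexed by `S`. -/
@[simps]
def Coalgebra.copower (P : W.Coalgebra) : Type u ⥤ W.Coalgebra where
  obj S :=
    { A := fun z => S × P.A z
      a := copowerStr P S
      counit := by
        funext z
        ext t
        exact (counit_map_apply _ z _).trans (congrArg (Prod.mk t.1) (P.counit_apply z t.2))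
      coassoc := by
        funext z
        ext t
        refine (delta_map_apply _ z _).trans ?_
        refine (congrArg (W.map (W.map _) z) (P.coassoc_apply z t.2)).trans ?_
        exact (map_map_apply _ _ z _).trans
          (map_map_apply (fun _ => ↾fun e => (t.1, e)) (copowerStr P S) z (P.a z t.2)).symm }
  map f :=
    { f := fun z => ↾fun t => (f t.1, t.2)
      h := by
        funext z
        ext t
        exact map_map_apply _ _ z _ }

variable [PreservesFiniteLimits W.toFunctor]

variable (W) in
-- As `W` preserves the terminal family, `W 1` has exactly one element over each `z`; it is pushed
-- forward along `s : 1 → S`.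
noncomputable def constStr (S : Type u) : (fun _ : Z => S) ⟶ W.obj fun _ : Z => S :=
  fun z => ↾fun s => W.map (fun _ => ↾fun _ => s) z (mapUnitElement W.toFunctor z)

variable (W) in
/-- The constant coalgebra on a set. -/
@[simps]
noncomputable def constCoalgebra : Type u ⥤ W.Coalgebra where
  obj S :=
    { A := fun _ => S
      a := constStr W S
      counit := by
        funext z
        ext s
        exact counit_map_apply _ z _
      coassoc := by
        funext z
        ext s
        refine (delta_map_apply _ z _).trans ?_
        refine Eq.trans (congrArg (W.map (W.map _) z) ?_)
          ((map_map_apply (fun z => ↾fun _ => mapUnitElement W.toFunctor z) (W.map _) z _).trans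
            (map_map_apply (fun _ => ↾fun _ => s) (constStr W S) z (mapUnitElement W.toFunctor z)).symm)
        exact eq_of_isTerminal (IsTerminal.isTerminalObj W.toFunctor _
          (mapUnitIsTerminal W.toFunctor)) z _ _ }
  map f :=
    { f := fun z => ↾fun s => f s
      h := by
        funext z
        ext s
        exact map_map_apply _ _ z _ }

/-- The projection from a copower to a constant coalgebra. -/
noncomputable def Coalgebra.copowerFst (P : W.Coalgebra) : P.copower ⟶ W.constCoalgebra where
  app S :=
    { f := fun z => ↾fun t => t.1
      h := by
        funext z
        ext t
        refine (map_map_apply _ _ z _).trans ?_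
        refine (map_map_apply (fun _ => ↾fun _ => PUnit.unit) (fun _ => ↾fun _ => t.1) z _).symm.trans
          (congrArg (W.map _ z) ?_)
        exact eq_of_isTerminal (mapUnitIsTerminal W.toFunctor) z _ _ }

/-- The projection from a copower to the coalgebra itself. -/
def Coalgebra.copowerSnd (P : W.Coalgebra) (S : Type u) : P.copower.obj S ⟶ P where
  f := fun z => ↾fun t => t.2
  h := by
    funext z
    ext t
    refine (map_map_apply _ _ z _).trans ?_
    exact Pi.map_id_apply W.toFunctor P.A z _

end CategoryTheory.Comonad

end Coalgebras

/-! ### Natural transformations out of the underlying families of diagrams of coalgebras -/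

section Density

variable {C : Type u} [SmallCategory C] {X : Type u} (V : Comonad (X → Type u))

/-- The pullback along `φ` of the underlying family of a diagram of coalgebras. -/
def diagramFam {Z : Type u} (φ : Z → C × X) : (C ⥤ V.Coalgebra) ⥤ (Z → Type u) :=
  ((Functor.whiskeringRight C _ _).obj V.forget ⋙ famOb C X) ⋙ pullFam φ

/-- Diagrams of constant coalgebras. -/
noncomputable def constDiagram [PreservesFiniteLimits V.toFunctor] :
    (C ⥤ Type u) ⥤ (C ⥤ V.Coalgebra) :=
  (Functor.whiskeringRight C _ _).obj V.constCoalgebra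

variable {V}

/-- The product of a representable functor and a coalgebra. -/
def reprCopower (c : C) (P : V.Coalgebra) : C ⥤ V.Coalgebra :=
  coyoneda.obj (Opposite.op c) ⋙ P.copower

/-- The co-Yoneda action: an element `e` of `Q.obj c` is the image of `(𝟙 c, e)`. -/
def reprCopowerAct (Q : C ⥤ V.Coalgebra) (c : C) : reprCopower c (Q.obj c) ⟶ Q where
  app d :=
    { f := fun x => ↾fun t => (Q.map t.1).f x t.2
      h := by
        funext x
        ext t
        exact (Comonad.map_map_apply _ _ x _).trans (Comonad.Coalgebra.Hom.apply (Q.map t.1) x t.2) }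
  naturality d d' g := by
    refine Comonad.Coalgebra.Hom.ext (funext fun x => ?_)
    ext t
    exact congrArg (fun k : Q.obj c ⟶ Q.obj d' => k.f x t.2) (Q.map_comp t.1 g)

noncomputable def reprCopowerFst [PreservesFiniteLimits V.toFunctor] (c : C) (P : V.Coalgebra) :
    reprCopower c P ⟶ (constDiagram V).obj (coyoneda.obj (Opposite.op c)) :=
  Functor.whiskerLeft _ P.copowerFst

def reprCopowerSnd (c : C) (P : V.Coalgebra) : reprCopower c P ⟶ (Functor.const C).obj P where
  app _ := P.copowerSnd _
  naturality _ _ _ := rfl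

variable {Z : Type u} {φ ψ : Z → C × X}

lemma diagramFam_id_apply (Q : C ⥤ V.Coalgebra) (z : Z) (e : (diagramFam V φ).obj Q z) :
    (diagramFam V φ).map (reprCopowerAct Q (φ z).1) z (𝟙 (φ z).1, e) = e :=
  congrArg (fun k : Q.obj (φ z).1 ⟶ Q.obj (φ z).1 => k.f (φ z).2 e) (Q.map_id (φ z).1)

variable [PreservesFiniteLimits V.toFunctor] {H : (Z → Type u) ⥤ (Z → Type u)}
  [PreservesFiniteLimits H]

/-- By naturality along `reprCopowerAct` it is enough to compare values at `(𝟙, e)`. The two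
projections of the copower are jointly injective, remain so under `H`, and land in the two kinds of
diagrams of the hypotheses. -/
lemma diagramFam_natTrans_ext {θ θ' : diagramFam V φ ⟶ diagramFam V ψ ⋙ H}
    (h₁ : ∀ F : C ⥤ Type u, θ.app ((constDiagram V).obj F) = θ'.app ((constDiagram V).obj F))
    (h₂ : ∀ P : V.Coalgebra, θ.app ((Functor.const C).obj P) = θ'.app ((Functor.const C).obj P)) :
    θ = θ' := by
  ext Q z e
  refine (congrArg (θ.app Q z) (diagramFam_id_apply Q z e)).symm.trans
    (Eq.trans ?_ (congrArg (θ'.app Q z) (diagramFam_id_apply Q z e)))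
  refine (Pi.naturality_apply θ (reprCopowerAct Q (φ z).1) z _).trans
    (Eq.trans (congrArg _ ?_) (Pi.naturality_apply θ' (reprCopowerAct Q (φ z).1) z _).symm)
  refine jointly_injective_map H
    (f := (diagramFam V ψ).map (reprCopowerFst (φ z).1 (Q.obj (φ z).1)))
    (g := (diagramFam V ψ).map (reprCopowerSnd (φ z).1 (Q.obj (φ z).1)))
    (fun z e e' h h' => Prod.ext h h') z _ _ ?_ ?_
  · refine (Pi.naturality_apply θ (reprCopowerFst _ _) z _).symm.trans
      (Eq.trans ?_ (Pi.naturality_apply θ' (reprCopowerFst _ _) z _))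
    rw [h₁]
  · refine (Pi.naturality_apply θ (reprCopowerSnd _ _) z _).symm.trans
      (Eq.trans ?_ (Pi.naturality_apply θ' (reprCopowerSnd _ _) z _))
    rw [h₂]

/-- The value at `e` is forced: `H` preserves products, so `σ` at `𝟙` and `τ` at `e` pair to an
element of `H` of a copower, which the action carries into `Q`. No compatibility between `σ` and `τ`
is needed, as a constant diagram of constant opens is reached from the terminal one. -/
lemma exists_diagramFam_natTrans
    (σ : constDiagram V ⋙ diagramFam V φ ⟶ constDiagram V ⋙ diagramFam V ψ ⋙ H)
    (τ : Functor.const C ⋙ diagramFam V φ ⟶ Functor.const C ⋙ diagramFam V ψ ⋙ H) :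
    ∃ θ : diagramFam V φ ⟶ diagramFam V ψ ⋙ H,
      (∀ F : C ⥤ Type u, θ.app ((constDiagram V).obj F) = σ.app F) ∧
      ∀ P : V.Coalgebra, θ.app ((Functor.const C).obj P) = τ.app P := by
  let fam : C → V.Coalgebra → Z → Type u := fun c P => (diagramFam V ψ).obj (reprCopower c P)
  let fst : ∀ c P, fam c P ⟶ fun z => c ⟶ (ψ z).1 := fun c P => famFst _ _
  let snd : ∀ c P, fam c P ⟶ fun z => P.A (ψ z).2 := fun c P => famSnd _ _
  have hpair : ∀ (z : Z) (P : V.Coalgebra) (e : P.A (φ z).2), ∃ w : H.obj (fam (φ z).1 P) z,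
      H.map (fst _ _) z w = σ.app (coyoneda.obj (Opposite.op (φ z).1)) z (𝟙 (φ z).1) ∧
      H.map (snd _ _) z w = τ.app P z e := fun z P e => exists_pair H _ _
  choose w hw₁ hw₂ using hpair
  have hext : ∀ (z : Z) (P : V.Coalgebra) (w w' : H.obj (fam (φ z).1 P) z),
      H.map (fst _ _) z w = H.map (fst _ _) z w' → H.map (snd _ _) z w = H.map (snd _ _) z w' →
      w = w' := fun z P =>
    jointly_injective_map H (f := fst _ _) (g := snd _ _) (fun _ _ _ h h' => Prod.ext h h') z
  let act : ∀ (Q : C ⥤ V.Coalgebra) c, fam c (Q.obj c) ⟶ (diagramFam V ψ).obj Q :=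
    fun Q c => (diagramFam V ψ).map (reprCopowerAct Q c)
  have hmap : ∀ {A B D : Z → Type u} (f : A ⟶ B) (g : B ⟶ D) (z : Z) (w : H.obj A z),
      H.map g z (H.map f z w) = H.map (f ≫ g) z w := fun f g z w =>
    (Pi.map_comp_apply H f g z w).symm
  refine ⟨{ app := fun Q z => ↾fun e => H.map (act Q (φ z).1) z (w z (Q.obj (φ z).1) e),
            naturality := fun Q Q' m => ?_ }, fun F => ?_, fun P => ?_⟩
  · funext z
    ext e
    change H.map (act Q' (φ z).1) z (w z (Q'.obj (φ z).1) ((m.app (φ z).1).f (φ z).2 e)) =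
      H.map ((diagramFam V ψ).map m) z (H.map (act Q (φ z).1) z (w z (Q.obj (φ z).1) e))
    let k : fam (φ z).1 (Q.obj (φ z).1) ⟶ fam (φ z).1 (Q'.obj (φ z).1) :=
      fun z' => ↾fun t => (t.1, (m.app (φ z).1).f (ψ z').2 t.2)
    have h₁ : w z (Q'.obj (φ z).1) ((m.app (φ z).1).f (φ z).2 e) =
        H.map k z (w z (Q.obj (φ z).1) e) := by
      refine hext z _ _ _ ?_ ?_
      · rw [hw₁, hmap]
        exact (hw₁ z (Q.obj (φ z).1) e).symm
      · rw [hw₂, hmap]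
        refine (Pi.naturality_apply τ (m.app (φ z).1) z e).trans ?_
        exact (congrArg _ (hw₂ z (Q.obj (φ z).1) e).symm).trans (hmap (snd _ _)
          (fun z' => (m.app (φ z).1).f (ψ z').2) z _)
    rw [h₁, hmap, hmap]
    refine congrArg (fun k : fam (φ z).1 (Q.obj (φ z).1) ⟶ (diagramFam V ψ).obj Q' =>
      H.map k z (w z (Q.obj (φ z).1) e)) ?_
    funext z'
    ext t
    exact congrArg (fun k : Q.obj (φ z).1 ⟶ Q'.obj (ψ z').1 => k.f (ψ z').2 t.2)
      (m.naturality t.1).symm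
  · funext z
    ext e
    let S := F.obj (φ z).1
    let P := V.constCoalgebra.obj S
    change H.map (act ((constDiagram V).obj F) (φ z).1) z (w z P e) = σ.app F z e
    let j : (fun z' => (φ z).1 ⟶ (ψ z').1) ⟶ fam (φ z).1 P :=
      fun z' => ↾fun (s : (φ z).1 ⟶ (ψ z').1) => ((s, e) : ((φ z).1 ⟶ (ψ z').1) × S)
    have h₁ : w z P e = H.map j z (σ.app (coyoneda.obj (Opposite.op (φ z).1)) z (𝟙 (φ z).1)) := by
      refine hext z _ _ _ ?_ ?_
      · exact (hw₁ z P e).trans ((hmap j (fst _ _) z _).trans (Pi.map_id_apply H _ z _)).symm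
      · refine (hw₂ z P e).trans (Eq.trans ?_ (hmap j (snd _ _) z _).symm)
        refine (Pi.naturality_apply τ (V.constCoalgebra.map (↾fun _ : PUnit.{u + 1} => e)) z
          PUnit.unit).trans ?_
        -- By naturality in the map `1 → S` picking `e`, the value of `τ` reduces to an element of
        -- `H 1`, which is unique.
        refine Eq.trans (congrArg _ ?_)
          (hmap (fun _ => ↾fun _ => PUnit.unit) (fun _ => ↾fun _ => e) z _)
        exact eq_of_isTerminal (mapUnitIsTerminal H) z _ _
    let k : fam (φ z).1 P ⟶ (diagramFam V ψ).obj ((constDiagram V).obj F) :=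
      act ((constDiagram V).obj F) (φ z).1
    refine (congrArg (H.map k z) h₁).trans ((hmap j k z _).trans ?_)
    -- By Yoneda, `e` is the image of `𝟙` under `y`, so naturality of `σ` along `y` yields its value
    -- at `F`.
    let y : coyoneda.obj (Opposite.op (φ z).1) ⟶ F := coyonedaEquiv.symm e
    have h₂ : y.app _ (𝟙 (φ z).1) = e := coyonedaEquiv.apply_symm_apply e
    refine Eq.trans ?_ ((Pi.naturality_apply σ y z (𝟙 (φ z).1)).symm.trans
      (congrArg (σ.app F z) h₂))
    rfl
  · funext z
    ext e
    exact hw₂ z P e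

end Density

/-! ### The tensor as a product -/

instance Ionad.preservesFiniteLimits_int (X : Ionad.{u}) :
    PreservesFiniteLimits X.int.toFunctor := X.cartesian

/-- In this normal form the compatibility condition is `rfl`, so liftings of the same function can
be compared by their structure transformations. -/
lemma Ionad.Map.exists_eq_mk {Z Y : Ionad.{u}} (f : Map Z Y) :
    ∃ (φ : Z.pts → Y.pts) (a : _) (h₁ : _) (h₂ : _),
      f = ⟨φ, Comonad.liftCoalgebra (Y.forgetOpens ⋙ pullFam φ) a h₁ h₂, rfl⟩ := by
  obtain ⟨φ, S, comm⟩ := f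
  obtain ⟨a, h₁, h₂, rfl⟩ := Comonad.exists_eq_liftCoalgebra comm
  exact ⟨φ, a, h₁, h₂, rfl⟩

/-- The continuous map to the terminal ionad. -/
noncomputable def toOneBIon (X : BIon.{u}) : X ⟶ oneBIon.{u} :=
  { toFun := fun _ => PUnit.unit
    star := oneOpensToSet ⋙ X.ion.int.constCoalgebra
    comm := rfl : Ionad.Map X.ion oneIonad }

section Product

variable (C : Cat.{u, u}) (X : BIon.{u})

noncomputable def tensorFst : tensorBIon C X ⟶ alexandroff.obj C :=
  { toFun := Prod.fst
    star := opensToFunctor C ⋙ constDiagram X.ion.int ⋙ diagramToOpens C X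
    comm := rfl : Ionad.Map (tensorBIon C X).ion (alexIonad C) }

noncomputable def tensorSnd : tensorBIon C X ⟶ X :=
  { toFun := Prod.snd
    star := Functor.const C ⋙ diagramToOpens C X
    comm := rfl : Ionad.Map (tensorBIon C X).ion X.ion }

lemma tensorUnit_fst : tensorUnit C X ⋙ postcomp X (tensorFst C X) =
    alexPoints C ⋙ precomp (alexandroff.obj C) (toOneBIon X) := by
  refine Ionad.functor_ext (fun c => rfl) ?_
  have h : opensToFunctor C ⋙ constDiagram X.ion.int ⋙
      (diagramToOpens C X ⋙ opensToDiagram C X) =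
      opensToFunctor C ⋙ constDiagram X.ion.int := by rw [diagramToOpens_opensToDiagram]; rfl
  exact congrArg Functor.flip h

lemma tensorUnit_snd : tensorUnit C X ⋙ postcomp X (tensorSnd C X) =
    (Functor.const C).obj (𝟙 X) := by
  refine Ionad.functor_ext (fun c => rfl) ?_
  have h : Functor.const C ⋙ (diagramToOpens C X ⋙ opensToDiagram C X) =
      Functor.const C := by rw [diagramToOpens_opensToDiagram]; rfl
  exact congrArg Functor.flip h

variable {C X}

lemma eq_of_diagramToOpens_app {A : Type*} [Category A]
    {F G : (tensorBIon C X).ion.Opens ⥤ A} {θ θ' : F ⟶ G}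
    (h : ∀ Q, θ.app ((diagramToOpens C X).obj Q) = θ'.app ((diagramToOpens C X).obj Q)) :
    θ = θ' := by
  ext P
  obtain ⟨Q, rfl⟩ := (toTensorOpens_isCatIso (C := C) (W := X.ion.int)).bijective_obj.2 P
  exact h Q

variable {Z : BIon.{u}} {φ ψ : Z.ion.pts → C × X.ion.pts}

/-- The underlying transformation of families of a transformation of liftings. -/
def diagramFamTrans {a h₁ h₂ b k₁ k₂}
    (θ : Comonad.liftCoalgebra (G := Z.ion.int)
        ((tensorBIon C X).ion.forgetOpens ⋙ pullFam φ) a h₁ h₂ ⟶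
      Comonad.liftCoalgebra ((tensorBIon C X).ion.forgetOpens ⋙ pullFam ψ) b k₁ k₂) :
    diagramFam X.ion.int φ ⟶ diagramFam X.ion.int ψ ⋙ 𝟭 _ where
  app Q := (θ.app ((diagramToOpens C X).obj Q)).f
  naturality _ _ m := congrArg Comonad.Coalgebra.Hom.f
    (θ.naturality ((diagramToOpens C X).map m))

/-- The natural coalgebra structure on the families of a lifting. -/
def diagramFamStr (a : (tensorBIon C X).ion.forgetOpens ⋙ pullFam φ ⟶
      ((tensorBIon C X).ion.forgetOpens ⋙ pullFam φ) ⋙ Z.ion.int.toFunctor) :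
    diagramFam X.ion.int φ ⟶ diagramFam X.ion.int φ ⋙ Z.ion.int.toFunctor :=
  Functor.whiskerLeft (diagramToOpens C X) a

lemma liftTrans_ext {a h₁ h₂ b k₁ k₂}
    {θ θ' : Comonad.liftCoalgebra (G := Z.ion.int)
        ((tensorBIon C X).ion.forgetOpens ⋙ pullFam φ) a h₁ h₂ ⟶
      Comonad.liftCoalgebra ((tensorBIon C X).ion.forgetOpens ⋙ pullFam ψ) b k₁ k₂}
    (H₁ : ∀ O, θ.app ((Ionad.Map.star (tensorFst C X)).obj O) =
      θ'.app ((Ionad.Map.star (tensorFst C X)).obj O))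
    (H₂ : ∀ O, θ.app ((Ionad.Map.star (tensorSnd C X)).obj O) =
      θ'.app ((Ionad.Map.star (tensorSnd C X)).obj O)) : θ = θ' := by
  have key : diagramFamTrans θ = diagramFamTrans θ' := diagramFam_natTrans_ext
    (fun F => congrArg Comonad.Coalgebra.Hom.f (H₁ ((functorToOpens C).obj F)))
    (fun P => congrArg Comonad.Coalgebra.Hom.f (H₂ P))
  exact eq_of_diagramToOpens_app fun Q => Comonad.Coalgebra.Hom.ext (NatTrans.congr_app key Q)

lemma exists_liftTrans {a h₁ h₂ b k₁ k₂}
    (σ : Ionad.Map.star (tensorFst C X) ⋙ Comonad.liftCoalgebra (G := Z.ion.int)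
        ((tensorBIon C X).ion.forgetOpens ⋙ pullFam φ) a h₁ h₂ ⟶
      Ionad.Map.star (tensorFst C X) ⋙ Comonad.liftCoalgebra
        ((tensorBIon C X).ion.forgetOpens ⋙ pullFam ψ) b k₁ k₂)
    (τ : Ionad.Map.star (tensorSnd C X) ⋙ Comonad.liftCoalgebra (G := Z.ion.int)
        ((tensorBIon C X).ion.forgetOpens ⋙ pullFam φ) a h₁ h₂ ⟶
      Ionad.Map.star (tensorSnd C X) ⋙ Comonad.liftCoalgebra
        ((tensorBIon C X).ion.forgetOpens ⋙ pullFam ψ) b k₁ k₂) :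
    ∃ θ : Comonad.liftCoalgebra (G := Z.ion.int)
        ((tensorBIon C X).ion.forgetOpens ⋙ pullFam φ) a h₁ h₂ ⟶
      Comonad.liftCoalgebra ((tensorBIon C X).ion.forgetOpens ⋙ pullFam ψ) b k₁ k₂,
      Functor.whiskerLeft _ θ = σ ∧ Functor.whiskerLeft _ θ = τ := by
  obtain ⟨θ, hσ, hτ⟩ := exists_diagramFam_natTrans (V := X.ion.int) (φ := φ) (ψ := ψ) (H := 𝟭 _)
    { app := fun F => (σ.app ((functorToOpens C).obj F)).f
      naturality := fun _ _ m => congrArg Comonad.Coalgebra.Hom.f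
        (σ.naturality ((functorToOpens C).map m)) }
    { app := fun P => (τ.app P).f
      naturality := fun _ _ m => congrArg Comonad.Coalgebra.Hom.f (τ.naturality m) }
  let θ' : diagramFam X.ion.int φ ⟶ diagramFam X.ion.int ψ := θ
  -- Being a coalgebra map is an equation between transformations into `H = Z.ion.int`, so the two
  -- special kinds of diagrams suffice, where `σ` and `τ` supply it.
  have hc : diagramFamStr a ≫ Functor.whiskerRight θ' Z.ion.int.toFunctor =
      θ' ≫ diagramFamStr b := by
    refine diagramFam_natTrans_ext (fun F => ?_) (fun P => ?_)
    · have h := (σ.app ((functorToOpens C).obj F)).h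
      refine (congrArg (fun k => (diagramFamStr a).app _ ≫ Z.ion.int.map k) (hσ F)).trans
        (h.trans (congrArg (fun k => k ≫ (diagramFamStr b).app _) (hσ F).symm))
    · have h := (τ.app P).h
      refine (congrArg (fun k => (diagramFamStr a).app _ ≫ Z.ion.int.map k) (hτ P)).trans
        (h.trans (congrArg (fun k => k ≫ (diagramFamStr b).app _) (hτ P).symm))
  have : (diagramToOpens C X).IsEquivalence :=
    (toTensorOpens_isCatIso (C := C) (W := X.ion.int)).isEquivalence
  obtain ⟨Θ, hΘ⟩ := ((Functor.whiskeringLeft _ _ Z.ion.Opens).obj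
    (diagramToOpens C X)).map_surjective (X := Comonad.liftCoalgebra (G := Z.ion.int)
        ((tensorBIon C X).ion.forgetOpens ⋙ pullFam φ) a h₁ h₂)
      (Y := Comonad.liftCoalgebra ((tensorBIon C X).ion.forgetOpens ⋙ pullFam ψ) b k₁ k₂)
    { app := fun Q => { f := θ'.app Q, h := NatTrans.congr_app hc Q }
      naturality := fun _ _ m => Comonad.Coalgebra.Hom.ext (θ'.naturality m) }
  refine ⟨Θ, NatTrans.ext (funext fun O => ?_), NatTrans.ext (funext fun P => ?_)⟩
  · refine (NatTrans.congr_app hΘ ((constDiagram X.ion.int).obj ((opensToFunctor C).obj O))).trans ?_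
    exact Comonad.Coalgebra.Hom.ext (hσ ((opensToFunctor C).obj O))
  · refine (NatTrans.congr_app hΘ ((Functor.const C).obj P)).trans ?_
    exact Comonad.Coalgebra.Hom.ext (hτ P)

lemma liftCoalgebra_eq_of_star {a h₁ h₂ b k₁ k₂}
    (H₁ : Ionad.Map.star (tensorFst C X) ⋙ Comonad.liftCoalgebra (G := Z.ion.int)
        ((tensorBIon C X).ion.forgetOpens ⋙ pullFam φ) a h₁ h₂ =
      Ionad.Map.star (tensorFst C X) ⋙ Comonad.liftCoalgebra
        ((tensorBIon C X).ion.forgetOpens ⋙ pullFam φ) b k₁ k₂)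
    (H₂ : Ionad.Map.star (tensorSnd C X) ⋙ Comonad.liftCoalgebra (G := Z.ion.int)
        ((tensorBIon C X).ion.forgetOpens ⋙ pullFam φ) a h₁ h₂ =
      Ionad.Map.star (tensorSnd C X) ⋙ Comonad.liftCoalgebra
        ((tensorBIon C X).ion.forgetOpens ⋙ pullFam φ) b k₁ k₂) : a = b := by
  have key : diagramFamStr a = diagramFamStr b := diagramFam_natTrans_ext
    (fun F => eq_of_heq (Comonad.Coalgebra.a_heq
      (Functor.congr_obj H₁ ((functorToOpens C).obj F))))
    (fun P => eq_of_heq (Comonad.Coalgebra.a_heq (Functor.congr_obj H₂ P)))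
  exact eq_of_diagramToOpens_app fun Q => NatTrans.congr_app key Q

lemma exists_map_to_tensor (f : Z ⟶ alexandroff.obj C) (g : Z ⟶ X) :
    ∃ h : Z ⟶ tensorBIon C X, h ≫ tensorFst C X = f ∧ h ≫ tensorSnd C X = g := by
  obtain ⟨f₀, α, hα₁, hα₂, rfl⟩ := Ionad.Map.exists_eq_mk f
  obtain ⟨g₀, β, hβ₁, hβ₂, rfl⟩ := Ionad.Map.exists_eq_mk g
  let φ : Z.ion.pts → C × X.ion.pts := fun z => (f₀ z, g₀ z)
  obtain ⟨θ, hσ, hτ⟩ := exists_diagramFam_natTrans (V := X.ion.int) (φ := φ) (ψ := φ)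
    (H := Z.ion.int.toFunctor)
    { app := fun F => α.app ((functorToOpens C).obj F)
      naturality := fun _ _ m => α.naturality ((functorToOpens C).map m) }
    { app := fun P => β.app P
      naturality := fun _ _ m => β.naturality m }
  -- The coalgebra axioms are tested on the two kinds of diagrams, with `H` the identity for the
  -- counit and the square of the comonad for coassociativity.
  have h₁ : θ ≫ Functor.whiskerLeft (diagramFam X.ion.int φ) Z.ion.int.ε =
      𝟙 (diagramFam X.ion.int φ) := by
    refine diagramFam_natTrans_ext (H := 𝟭 (Z.ion.pts → Type u)) (fun F => ?_) (fun P => ?_)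
    · exact (congrArg (fun k => k ≫ Z.ion.int.ε.app _) (hσ F)).trans (hα₁ _)
    · exact (congrArg (fun k => k ≫ Z.ion.int.ε.app _) (hτ P)).trans (hβ₁ _)
  have h₂ : θ ≫ Functor.whiskerLeft (diagramFam X.ion.int φ) Z.ion.int.δ =
      θ ≫ Functor.whiskerRight θ Z.ion.int.toFunctor := by
    refine diagramFam_natTrans_ext (H := Z.ion.int.toFunctor ⋙ Z.ion.int.toFunctor)
      (fun F => ?_) (fun P => ?_)
    · exact (congrArg (fun k => k ≫ Z.ion.int.δ.app _) (hσ F)).trans ((hα₂ _).trans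
        (congrArg (fun k => k ≫ Z.ion.int.map k) (hσ F).symm))
    · exact (congrArg (fun k => k ≫ Z.ion.int.δ.app _) (hτ P)).trans ((hβ₂ _).trans
        (congrArg (fun k => k ≫ Z.ion.int.map k) (hτ P).symm))
  let S : (C ⥤ X.ion.Opens) ⥤ Z.ion.Opens := Comonad.liftCoalgebra (diagramFam X.ion.int φ) θ
    (fun Q => NatTrans.congr_app h₁ Q) (fun Q => NatTrans.congr_app h₂ Q)
  refine ⟨(⟨φ, opensToDiagram C X ⋙ S, ?_⟩ : Ionad.Map Z.ion (tensorBIon C X).ion), ?_, ?_⟩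
  · have : (opensToDiagram C X ⋙ diagramToOpens C X) ⋙ (tensorBIon C X).ion.forgetOpens ⋙
      pullFam φ = (tensorBIon C X).ion.forgetOpens ⋙ pullFam φ := by
        rw [opensToDiagram_diagramToOpens]; rfl
    exact this
  · refine Ionad.Map.ext rfl ?_
    have h : opensToFunctor C ⋙ constDiagram X.ion.int ⋙
      (diagramToOpens C X ⋙ opensToDiagram C X) ⋙ S =
      opensToFunctor C ⋙ constDiagram X.ion.int ⋙ S := by
        rw [diagramToOpens_opensToDiagram]; rfl
    refine Eq.trans h ?_
    exact Comonad.liftCoalgebra_congr (G := Z.ion.int)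
      (K := opensToFunctor C ⋙ constDiagram X.ion.int ⋙ diagramFam X.ion.int φ)
      (a := Functor.whiskerLeft (opensToFunctor C ⋙ constDiagram X.ion.int) θ)
      (h₁ := fun O => NatTrans.congr_app h₁ _) (h₂ := fun O => NatTrans.congr_app h₂ _)
      rfl fun O => heq_of_eq (hσ ((opensToFunctor C).obj O))
  · refine Ionad.Map.ext rfl ?_
    have h : Functor.const C ⋙ (diagramToOpens C X ⋙ opensToDiagram C X) ⋙ S =
      Functor.const C ⋙ S := by
        rw [diagramToOpens_opensToDiagram]; rfl
    refine Eq.trans h ?_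
    exact Comonad.liftCoalgebra_congr (G := Z.ion.int)
      (K := Functor.const C ⋙ diagramFam X.ion.int φ)
      (a := Functor.whiskerLeft (Functor.const C) θ)
      (h₁ := fun O => NatTrans.congr_app h₁ _) (h₂ := fun O => NatTrans.congr_app h₂ _)
      rfl fun P => heq_of_eq (hτ P)

end Product

theorem isProduct_tensor (C : Cat.{u, u}) (X : BIon.{u}) :
    IsProduct (tensorFst C X) (tensorSnd C X) := by
  intro Z
  have : (Functor.prod' (postcomp Z (tensorFst C X)) (postcomp Z (tensorSnd C X))).Faithful :=
    ⟨fun {h k} θ θ' e => by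
      obtain ⟨φ, a, ha₁, ha₂, rfl⟩ := Ionad.Map.exists_eq_mk h
      obtain ⟨ψ, b, hb₁, hb₂, rfl⟩ := Ionad.Map.exists_eq_mk k
      refine Ionad.hom₂_ext (liftTrans_ext (fun O => ?_) fun O => ?_)
      · exact NatTrans.congr_app (congrArg Ionad.Specialisation.nat (congrArg Prod.fst e)) O
      · exact NatTrans.congr_app (congrArg Ionad.Specialisation.nat (congrArg Prod.snd e)) O⟩
  have : (Functor.prod' (postcomp Z (tensorFst C X)) (postcomp Z (tensorSnd C X))).Full :=
    ⟨fun {h k} σ => by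
      obtain ⟨φ, a, ha₁, ha₂, rfl⟩ := Ionad.Map.exists_eq_mk h
      obtain ⟨ψ, b, hb₁, hb₂, rfl⟩ := Ionad.Map.exists_eq_mk k
      obtain ⟨θ, h₁, h₂⟩ := exists_liftTrans (Ionad.Specialisation.nat σ.1)
        (Ionad.Specialisation.nat σ.2)
      exact ⟨(⟨θ⟩ : Ionad.Specialisation (X := Z.ion) (Y := (tensorBIon C X).ion)
          ⟨φ, Comonad.liftCoalgebra _ a ha₁ ha₂, rfl⟩
          ⟨ψ, Comonad.liftCoalgebra _ b hb₁ hb₂, rfl⟩),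
        Prod.ext (Ionad.hom₂_ext h₁) (Ionad.hom₂_ext h₂)⟩⟩
  refine IsCatIso.of_bijective _ ⟨fun h k e => ?_, fun f => ?_⟩
  · obtain ⟨φ, a, ha₁, ha₂, rfl⟩ := Ionad.Map.exists_eq_mk h
    obtain ⟨ψ, b, hb₁, hb₂, rfl⟩ := Ionad.Map.exists_eq_mk k
    have e₁ := (Prod.ext_iff.mp e).1
    have e₂ := (Prod.ext_iff.mp e).2
    obtain rfl : φ = ψ := funext fun z =>
      Prod.ext (congrFun (congrArg Ionad.Map.toFun e₁) z) (congrFun (congrArg Ionad.Map.toFun e₂) z)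
    obtain rfl : a = b := liftCoalgebra_eq_of_star (congrArg Ionad.Map.star e₁)
      (congrArg Ionad.Map.star e₂)
    rfl
  · obtain ⟨h, h₁, h₂⟩ := exists_map_to_tensor f.1 f.2
    exact ⟨h, Prod.ext h₁ h₂⟩

/-- Every tensor of a bounded ionad by a small category is a product. -/
theorem IsTensor.exists_isProduct {C : Cat.{u, u}} {X T : BIon.{u}} {η : C ⥤ (X ⟶ T)}
    (hη : IsTensor η) :
    ∃ (t : X ⟶ oneBIon.{u}) (p : T ⟶ alexandroff.obj C) (q : T ⟶ X),
      η ⋙ postcomp X p = alexPoints C ⋙ precomp (alexandroff.obj C) t ∧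
      η ⋙ postcomp X q = (Functor.const C).obj (𝟙 X) ∧
      IsProduct p q := by
  obtain ⟨e, he⟩ := hη.exists_fac (tensorUnit C X)
  obtain ⟨e', he'⟩ := (isTensor_tensorUnit C X).exists_fac η
  have h₁ : e ≫ e' = 𝟙 T := hη.hom_ext (by
    exact (congrArg (fun k => k ⋙ postcomp X e') he).trans he')
  have h₂ : e' ≫ e = 𝟙 _ := (isTensor_tensorUnit C X).hom_ext (by
    exact (congrArg (fun k => k ⋙ postcomp X e) he').trans he)
  refine ⟨toOneBIon X, e ≫ tensorFst C X, e ≫ tensorSnd C X, ?_, ?_, fun Z => ?_⟩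
  · exact (congrArg (fun k => k ⋙ postcomp X (tensorFst C X)) he).trans (tensorUnit_fst C X)
  · exact (congrArg (fun k => k ⋙ postcomp X (tensorSnd C X)) he).trans (tensorUnit_snd C X)
  · have h : IsCatIso (postcomp Z e) := ⟨postcomp Z e',
      congrArg (fun k => postcomp Z k) h₁, congrArg (fun k => postcomp Z k) h₂⟩
    exact h.comp (isProduct_tensor C X Z)

/-! ### Representability of the points by small categories -/

namespace SmallRepresentable

variable {X : BIon.{u}} {D : BIon.{u} → Cat.{u, u}} {iso : ∀ Y : BIon.{u}, D Y ⥤ (X ⟶ Y)}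
  (inv : ∀ Y : BIon.{u}, (X ⟶ Y) ⥤ D Y)

/-- The action of a continuous map, transported along isomorphisms of categories. -/
def transportMap (iso : ∀ Y : BIon.{u}, D Y ⥤ (X ⟶ Y)) {Y Z : BIon.{u}} (f : Y ⟶ Z) : D Y ⟶ D Z :=
  ⟨iso Y ⋙ postcomp X f ⋙ inv Z⟩

/-- The action of a specialisation, transported along isomorphisms of categories. -/
def transportMap₂ (iso : ∀ Y : BIon.{u}, D Y ⥤ (X ⟶ Y)) {Y Z : BIon.{u}} {f g : Y ⟶ Z}
    (θ : f ⟶ g) : transportMap inv iso f ⟶ transportMap inv iso g :=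
  ⟨Functor.whiskerLeft (iso Y) (Functor.whiskerRight ((postcomposing X Y Z).map θ) (inv Z))⟩

variable {inv}

lemma transportMap_iso (h : ∀ Y, inv Y ⋙ iso Y = 𝟭 _) {Y Z : BIon.{u}} (f : Y ⟶ Z) :
    (transportMap inv iso f).toFunctor ⋙ iso Z = iso Y ⋙ postcomp X f :=
  congrArg (fun k => (iso Y ⋙ postcomp X f) ⋙ k) (h Z)

lemma transportMap₂_heq (h : ∀ Y, inv Y ⋙ iso Y = 𝟭 _) {Y Z : BIon.{u}} {f g : Y ⟶ Z}
    (θ : f ⟶ g) (d : D Y) :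
    (iso Z).map ((transportMap₂ inv iso θ).toNatTrans.app d) ≍ (iso Y).obj d ◁ θ :=
  Functor.hcongr_hom (h Z) ((iso Y).obj d ◁ θ)

lemma transport_hom₂_heq (h : ∀ Y, IsCatIso (iso Y)) {E : Cat.{u, u}} {Z : BIon.{u}}
    {F F' G G' : E ⟶ D Z}
    (e : F = F') (e' : G = G') {α : F ⟶ G} {α' : F' ⟶ G'}
    (H : ∀ d, (iso Z).map (α.toNatTrans.app d) ≍ (iso Z).map (α'.toNatTrans.app d)) : α ≍ α' := by
  subst e e'
  have := (h Z).isEquivalence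
  exact heq_of_eq (Cat.Hom₂.ext (NatTrans.ext (funext fun d =>
    (iso Z).map_injective (eq_of_heq (H d)))))

/-- Pointwise isomorphisms with small categories make a representable 2-functor small. -/
noncomputable def ofIsCatIso (h : ∀ Y, IsCatIso (iso Y)) : SmallRepresentable.{u} X :=
  let inv : ∀ Y : BIon.{u}, (X ⟶ Y) ⥤ D Y := fun Y => (h Y).choose
  have h₁ : ∀ Y, iso Y ⋙ inv Y = 𝟭 _ := fun Y => (h Y).choose_spec.1
  have h₂ : ∀ Y, inv Y ⋙ iso Y = 𝟭 _ := fun Y => (h Y).choose_spec.2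
  have map_id : ∀ Y, transportMap inv iso (𝟙 Y) = 𝟙 (D Y) := fun Y => Cat.ext (h₁ Y)
  have map_comp : ∀ {Y Z W : BIon.{u}} (f : Y ⟶ Z) (g : Z ⟶ W),
      transportMap inv iso (f ≫ g) = transportMap inv iso f ≫ transportMap inv iso g :=
    fun {Y Z W} f g => Cat.ext (congrArg
      (fun k => (iso Y ⋙ postcomp X f) ⋙ k ⋙ postcomp X g ⋙ inv W) (h₂ Z)).symm
  { functor := StrictPseudofunctor.mk''
      { obj := D
        map := fun f => transportMap inv iso f
        map₂ := fun θ => transportMap₂ inv iso θ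
        map₂_id := fun {Y Z} f => Cat.Hom₂.ext (NatTrans.ext (funext fun d =>
          (congrArg (inv Z).map (Bicategory.whiskerLeft_id _ _)).trans
            (CategoryTheory.Functor.map_id _ _)))
        map₂_comp := fun {Y Z _ _ _} a b => Cat.Hom₂.ext (NatTrans.ext (funext fun d =>
          (congrArg (inv Z).map (Bicategory.whiskerLeft_comp _ _ _)).trans
            (CategoryTheory.Functor.map_comp _ _ _)))
        map_id := map_id
        map_comp := map_comp
        map₂_whisker_left := fun {Y Z W} f g g' θ => by
          refine (conj_eqToHom_iff_heq _ _ (map_comp f g) (map_comp f g')).mpr ?_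
          refine transport_hom₂_heq h (map_comp f g) (map_comp f g') fun d => ?_
          refine (transportMap₂_heq h₂ (f ◁ θ) d).trans
            (HEq.trans ?_ (transportMap₂_heq h₂ θ ((transportMap inv iso f).toFunctor.obj d)).symm)
          exact BIon.whiskerLeft_heq (Functor.congr_obj (transportMap_iso h₂ f) d).symm θ
        map₂_whisker_right := fun {Y Z W} f f' θ g => by
          refine (conj_eqToHom_iff_heq _ _ (map_comp f g) (map_comp f' g)).mpr ?_
          refine transport_hom₂_heq h (map_comp f g) (map_comp f' g) fun d => ?_
          refine (transportMap₂_heq h₂ (θ ▷ g) d).trans (HEq.trans ?_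
            (Functor.hcongr_hom (transportMap_iso h₂ g)
              ((transportMap₂ inv iso θ).toNatTrans.app d)).symm)
          exact BIon.whiskerRight_heq (Functor.congr_obj (transportMap_iso h₂ f) d).symm
            (Functor.congr_obj (transportMap_iso h₂ f') d).symm (transportMap₂_heq h₂ θ d).symm g }
    iso := iso
    isIso := h
    naturality := transportMap_iso h₂
    naturality₂ := fun {Y Z f g} θ => by
      refine (comp_eqToHom_eq_iff_heq _ _).mpr ?_
      exact NatTrans.heq_of_app (transportMap_iso h₂ f) (transportMap_iso h₂ g)
        (transportMap₂_heq h₂ θ) }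

end SmallRepresentable

/-! ### Smallness of specialisations between points of a bounded ionad -/

section Comparison

variable {A D : Type*} [Category A] [Category D] {L : A ⥤ D} {R : D ⥤ A} {adj : L ⊣ R}
  {I : Comonad D}

/-- The comparison functor of an adjunction, for a comonad isomorphic to the induced one. -/
def comparisonOfIso (k : R ⋙ L ≅ I.toFunctor)
    (hε : ∀ Y, k.hom.app Y ≫ I.ε.app Y = adj.counit.app Y)
    (hδ : ∀ Y, k.hom.app Y ≫ I.δ.app Y =
      L.map (adj.unit.app (R.obj Y)) ≫ k.hom.app (L.obj (R.obj Y)) ≫ I.map (k.hom.app Y)) :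
    A ⥤ I.Coalgebra :=
  Comonad.liftCoalgebra L
    { app := fun Q => L.map (adj.unit.app Q) ≫ k.hom.app (L.obj Q)
      naturality := fun Q Q' m => by
        have h := k.hom.naturality (L.map m)
        dsimp at h ⊢
        rw [Category.assoc, ← h, ← Category.assoc, ← Category.assoc, ← L.map_comp, ← L.map_comp,
          adj.unit_naturality] }
    (fun Q => by
      dsimp
      rw [Category.assoc, hε, adj.left_triangle_components])
    (fun Q => by
      have h := k.hom.naturality (L.map (adj.unit.app Q))
      dsimp at h ⊢
      rw [Category.assoc, hδ, CategoryTheory.Functor.map_comp I.toFunctor, ← Category.assoc,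
        ← L.map_comp, ← adj.unit_naturality, L.map_comp, Category.assoc, Category.assoc,
        reassoc_of% h])

/-- The coalgebra map into the comparison coalgebra of its underlying object. -/
def toComparisonOfIso (k : R ⋙ L ≅ I.toFunctor)
    (hε : ∀ Y, k.hom.app Y ≫ I.ε.app Y = adj.counit.app Y)
    (hδ : ∀ Y, k.hom.app Y ≫ I.δ.app Y =
      L.map (adj.unit.app (R.obj Y)) ≫ k.hom.app (L.obj (R.obj Y)) ≫ I.map (k.hom.app Y))
    (P : I.Coalgebra) : P ⟶ (comparisonOfIso k hε hδ).obj (R.obj P.A) where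
  f := P.a ≫ k.inv.app P.A
  h := by
    have h : I.map (k.hom.app P.A) ≫ I.map (k.inv.app P.A) = 𝟙 _ := by
      rw [← CategoryTheory.Functor.map_comp, Iso.hom_inv_id_app, CategoryTheory.Functor.map_id]
    have h' : L.map (adj.unit.app (R.obj P.A)) ≫ k.hom.app (L.obj (R.obj P.A)) =
        k.hom.app P.A ≫ I.δ.app P.A ≫ I.map (k.inv.app P.A) := by
      rw [reassoc_of% (hδ P.A), h]
      exact congrArg (fun t => L.map (adj.unit.app (R.obj P.A)) ≫ t) (Category.comp_id _).symm
    change P.a ≫ I.map (P.a ≫ k.inv.app P.A) = (P.a ≫ k.inv.app P.A) ≫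
      L.map (adj.unit.app (R.obj P.A)) ≫ k.hom.app (L.obj (R.obj P.A))
    rw [h', CategoryTheory.Functor.map_comp, ← P.coassoc_assoc, Category.assoc,
      Iso.inv_hom_id_app_assoc]

lemma toComparisonOfIso_counit (k : R ⋙ L ≅ I.toFunctor)
    (hε : ∀ Y, k.hom.app Y ≫ I.ε.app Y = adj.counit.app Y)
    (hδ : ∀ Y, k.hom.app Y ≫ I.δ.app Y =
      L.map (adj.unit.app (R.obj Y)) ≫ k.hom.app (L.obj (R.obj Y)) ≫ I.map (k.hom.app Y))
    (P : I.Coalgebra) :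
    Comonad.Coalgebra.Hom.f (toComparisonOfIso k hε hδ P) ≫ adj.counit.app P.A = 𝟙 P.A := by
  change (P.a ≫ k.inv.app P.A) ≫ adj.counit.app P.A = 𝟙 P.A
  rw [← hε, Category.assoc, Iso.inv_hom_id_app_assoc, P.counit]

end Comparison

/-- Representables jointly cover `Q`, and left adjoints preserve joint epimorphy. Surjectivity is
tested with two families of truth values, the constant `True` and membership in the joint image,
which agree on every representable. -/
lemma exists_map_yoneda_of_adjunction {X B : Type u} [SmallCategory B]
    {L : (Bᵒᵖ ⥤ Type u) ⥤ (X → Type u)} {R : (X → Type u) ⥤ (Bᵒᵖ ⥤ Type u)} (adj : L ⊣ R)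
    (Q : Bᵒᵖ ⥤ Type u) (x : X) (e : L.obj Q x) :
    ∃ (b : B) (m : yoneda.obj b ⟶ Q) (e' : L.obj (yoneda.obj b) x), L.map m x e' = e := by
  let f : L.obj Q ⟶ (fun _ => ULift.{u} Prop) := fun z => ↾fun _ => ⟨True⟩
  let g : L.obj Q ⟶ (fun _ => ULift.{u} Prop) := fun z => ↾fun e =>
    ⟨∃ (b : B) (m : yoneda.obj b ⟶ Q) (e' : L.obj (yoneda.obj b) z), L.map m z e' = e⟩
  have h : ∀ (b : B) (m : yoneda.obj b ⟶ Q), L.map m ≫ f = L.map m ≫ g := fun b m => by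
    refine funext fun z => ?_
    ext e'
    exact ⟨fun _ => ⟨b, m, e', rfl⟩, fun _ => trivial⟩
  have hfg : f = g := by
    -- The transposes are maps out of `Q`, compared on elements `q`. By Yoneda, `q` is a map from a
    -- representable, where `h` applies.
    refine (adj.homEquiv _ _).injective (NatTrans.ext (funext fun c => ?_))
    ext q
    have key := (adj.homEquiv_naturality_left (yonedaEquiv.symm q) f).symm.trans
      ((congrArg (adj.homEquiv _ _) (h c.unop (yonedaEquiv.symm q))).trans
        (adj.homEquiv_naturality_left (yonedaEquiv.symm q) g))
    have key' := congrArg yonedaEquiv key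
    rw [yonedaEquiv_comp, yonedaEquiv_comp, Equiv.apply_symm_apply] at key'
    exact key'
  have h' := congrArg (fun k : L.obj Q ⟶ (fun _ => ULift.{u} Prop) => (k x e).down) hfg
  exact cast h' trivial

namespace Ionad

/-- The values of a specialisation between two points. -/
def specialisationFam {Y : Ionad.{u}} {x y : Y.pts} (θ : Y.point x ⟶ Y.point y) (P : Y.Opens) :
    P.A x → P.A y :=
  fun e => (Specialisation.nat θ |>.app P).f PUnit.unit e

lemma specialisationFam_naturality {Y : Ionad.{u}} {x y : Y.pts} (θ : Y.point x ⟶ Y.point y)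
    {P P' : Y.Opens} (m : P ⟶ P') (e : P.A x) :
    specialisationFam θ P' (m.f x e) = m.f y (specialisationFam θ P e) :=
  congrArg (fun k => k.f PUnit.unit e) ((Specialisation.nat θ).naturality m)

lemma specialisationFam_injective {Y : Ionad.{u}} {x y : Y.pts} {θ θ' : Y.point x ⟶ Y.point y}
    (h : ∀ P, specialisationFam θ P = specialisationFam θ' P) : θ = θ' := by
  refine hom₂_ext (NatTrans.ext (funext fun P => Comonad.Coalgebra.Hom.ext (funext fun _ => ?_)))
  ext e
  exact congrFun (h P) e

/-- A specialisation is determined by its components at the opens `K.obj (yoneda.obj b)`, and `B` is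
small. Indeed each open `P` maps injectively into `K.obj (R.obj P.A)`, whose elements come from
representables. -/
lemma small_specialisation {Y : Ionad.{u}} (hY : Y.IsBounded) (x y : Y.pts) :
    Small.{u} (Y.point x ⟶ Y.point y) := by
  obtain ⟨B, _, M, -, L, R, adj, -, ⟨κ⟩⟩ := hY
  let k : R ⋙ L ≅ Y.int.toFunctor := (comonadToFunctor _).mapIso κ
  have hε : ∀ A, k.hom.app A ≫ Y.int.ε.app A = adj.counit.app A := κ.hom.app_ε
  have hδ : ∀ A, k.hom.app A ≫ Y.int.δ.app A = L.map (adj.unit.app (R.obj A)) ≫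
    k.hom.app (L.obj (R.obj A)) ≫ Y.int.map (k.hom.app A) := κ.hom.app_δ
  let K := comparisonOfIso k hε hδ
  refine small_of_injective (β := ∀ b : B, (K.obj (yoneda.obj b)).A x → (K.obj (yoneda.obj b)).A y)
    (f := fun θ b => specialisationFam θ (K.obj (yoneda.obj b))) fun θ θ' h => ?_
  refine specialisationFam_injective fun P => funext fun e => ?_
  let i := toComparisonOfIso k hε hδ P
  -- The counit retracts `i` only on underlying families, which is enough for injectivity.
  have hi : Function.Injective (i.f y) := Function.LeftInverse.injective
    (g := adj.counit.app P.A y) fun e => congrArg (fun m : P.A ⟶ P.A => m y e)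
      (toComparisonOfIso_counit k hε hδ P)
  refine hi ?_
  rw [← specialisationFam_naturality, ← specialisationFam_naturality]
  obtain ⟨b, m, e', he'⟩ := exists_map_yoneda_of_adjunction adj (R.obj P.A) x (i.f x e)
  have hm : ∀ σ : Y.point x ⟶ Y.point y, specialisationFam σ (K.obj (R.obj P.A)) (i.f x e) =
      (K.map m).f y (specialisationFam σ (K.obj (yoneda.obj b)) e') := fun σ =>
    (congrArg (specialisationFam σ (K.obj (R.obj P.A))) he').symm.trans
      (specialisationFam_naturality σ (K.map m) e')
  exact (hm θ).trans ((congrArg (fun t => (K.map m).f y (t b e')) h).trans (hm θ').symm)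

/-- Coalgebra structures for the identity comonad are identities, so the lifting is determined by
the point. -/
lemma exists_eq_point {Y : Ionad.{u}} (f : oneIonad ⟶ Y) : ∃ y, f = Y.point y := by
  obtain ⟨φ, a, h₁, h₂, rfl⟩ := Map.exists_eq_mk f
  refine ⟨φ PUnit.unit, Map.ext rfl ?_⟩
  obtain ⟨a', h₁', h₂', h⟩ := Comonad.exists_eq_liftCoalgebra (Map.comm (Y.point (φ PUnit.unit)))
  refine Eq.trans ?_ h.symm
  refine Comonad.liftCoalgebra_congr rfl fun P => heq_of_eq ?_
  exact ((Category.comp_id _).symm.trans (h₁ P)).trans ((Category.comp_id _).symm.trans (h₁' P)).symm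

end Ionad

/-- The points of a bounded ionad, as the objects of a small category. -/
def PointCat (Y : BIon.{u}) : Type u := Y.ion.pts

namespace PointCat

variable {Y : BIon.{u}}

/-- The continuous map corresponding to a point. -/
def point (y : PointCat Y) : oneBIon.{u} ⟶ Y := Y.ion.point y

instance (x y : PointCat Y) : Small.{u} (x.point ⟶ y.point) :=
  Ionad.small_specialisation Y.bounded x y

noncomputable instance : SmallCategory (PointCat Y) where
  Hom x y := Shrink.{u} (x.point ⟶ y.point)
  id x := equivShrink (x.point ⟶ x.point) (𝟙 x.point)
  comp {x y z} f g := equivShrink (x.point ⟶ z.point)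
    ((equivShrink (x.point ⟶ y.point)).symm f ≫ (equivShrink (y.point ⟶ z.point)).symm g)
  id_comp f := by simp
  comp_id f := by simp
  assoc f g h := by simp

variable (Y)

/-- The identification of the category of points with the hom-category. -/
noncomputable def toHom : PointCat Y ⥤ (oneBIon.{u} ⟶ Y) where
  obj y := y.point
  map {x y} f := (equivShrink (x.point ⟶ y.point)).symm f
  map_id x := (equivShrink (x.point ⟶ x.point)).symm_apply_apply _
  map_comp {x _ z} _ _ := (equivShrink (x.point ⟶ z.point)).symm_apply_apply _

lemma isCatIso_toHom : IsCatIso (toHom Y) := by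
  have : (toHom Y).Faithful := ⟨fun {x y} _ _ h =>
    (equivShrink (x.point ⟶ y.point)).symm.injective h⟩
  have : (toHom Y).Full := ⟨fun {x y} f =>
    ⟨equivShrink (x.point ⟶ y.point) f, (equivShrink (x.point ⟶ y.point)).symm_apply_apply f⟩⟩
  refine IsCatIso.of_bijective _ ⟨fun x y h => ?_, fun f => ?_⟩
  · exact congrFun (congrArg Ionad.Map.toFun h) PUnit.unit
  · obtain ⟨y, rfl⟩ := Ionad.exists_eq_point f
    exact ⟨y, rfl⟩

end PointCat

/-- The specialisation 2-functor takes values in small categories. -/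
noncomputable def specialisationFunctor : SmallRepresentable.{u} oneBIon.{u} :=
  SmallRepresentable.ofIsCatIso (D := fun Y => Cat.of (PointCat Y))
    (iso := fun Y => PointCat.toHom Y) PointCat.isCatIso_toHom

theorem mainTheorem6 :
    -- tensors of bounded ionads by small categories: their bases, and their description as products
    (∀ (C : Cat.{u, u}) (X : BIon.{u}),
      (∀ (B : Type u) [SmallCategory B] (M : B ⥤ (X.ion.pts → Type u)),
        X.ion.IsGeneratedBy M →
          ∃ (I : Comonad (C × X.ion.pts → Type u)) (hI : PreservesFiniteLimits I.toFunctor)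
            (hM : Ionad.IsGeneratedBy ⟨C × X.ion.pts, I, hI⟩ (tensorBasis C M))
            (η : C ⥤ (X ⟶ (⟨⟨C × X.ion.pts, I, hI⟩, _, _, _, hM⟩ : BIon.{u}))),
            IsTensor η ∧ ∀ c : C, Ionad.Map.toFun (η.obj c) = fun x => (c, x)) ∧
      (∃ (T : BIon.{u}) (η : C ⥤ (X ⟶ T)), IsTensor η) ∧
      (∀ (T : BIon.{u}) (η : C ⥤ (X ⟶ T)), IsTensor η →
        ∃ (t : X ⟶ oneBIon.{u}) (p : T ⟶ alexandroff.obj C) (q : T ⟶ X),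
          η ⋙ postcomp X p = alexPoints C ⋙ precomp (alexandroff.obj C) t ∧
          η ⋙ postcomp X q = (Functor.const C).obj (𝟙 X) ∧
          IsProduct p q)) ∧
    -- the 2-functor `(–) ⊗ 1` and the specialisation 2-functor `V = BIon(1, –)` exist
    Nonempty (TensorFunctor.{u} oneBIon.{u}) ∧
    Nonempty (SmallRepresentable.{u} oneBIon.{u}) ∧
    -- `A ≅ (–) ⊗ 1` 2-naturally
    (∀ T : TensorFunctor.{u} oneBIon.{u}, ∃ φ : TwoNatIso alexandroff T.functor,
      ∀ C : Cat.{u, u}, alexPoints C ⋙ postcomp oneBIon.{u} (φ.hom.app C) = T.unit C) ∧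
    -- `(–) ⊗ 1 ⊣ V` and `A ⊣ V`
    (∀ V : SmallRepresentable.{u} oneBIon.{u},
      (∀ T : TensorFunctor.{u} oneBIon.{u}, Nonempty (TwoAdjunction T.functor V.functor)) ∧
      Nonempty (TwoAdjunction alexandroff.{u} V.functor)) := by
  refine ⟨fun C X => ⟨fun B _ M hM => ?_, ⟨_, _, isTensor_tensorUnit C X⟩,
    fun T η hη => hη.exists_isProduct⟩, ⟨alexTensorFunctor⟩, ⟨specialisationFunctor⟩,
    -- As `A` is itself a tensor 2-functor, both claims about it are instances of the general
    -- results.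
    fun T => ⟨alexTensorFunctor.uniqueUpToIso T, alexTensorFunctor.unit_comparison T⟩,
    fun V => ⟨fun T => ⟨V.adjunction T⟩, ⟨V.adjunction alexTensorFunctor⟩⟩⟩
  exact ⟨(tensorIonad C X.ion).int, (tensorIonad C X.ion).cartesian,
    tensorIonad_isGeneratedBy C X.ion hM, tensorUnit C X, isTensor_tensorUnit C X, fun c => rfl⟩
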